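/- For $n\ge 1$ and $X,Y\in\{0,1\}^n$ let $d_H(X,Y)=|\{i: X_i\ne Y_i\}|/n$. For probability distributions $D_1,D_2$ on $\{0,1\}^n$ let $d_{EM}(D_1,D_2)$ be the minimum of $\sum_{X,Y}f_{XY}\,d_H(X,Y)$ over all $f_{XY}\in[0,1]$ with $\sum_Y f_{XY}=D_1(X)$ for all $X$ and $\sum_X f_{XY}=D_2(Y)$ for all $Y$. For a permutation $\sigma$ of $[n]$ let $D_\sigma$ be the distribution with $D_\sigma(w_{\sigma(1)},\dots,w_{\sigma(n)})=D(w_1,\dots,w_n)$. Say that $D$ is $\beta$-close to VC-dimension $d$ if there is a distribution $D_0$ on $\{0,1\}^n$ whose support has VC-dimension at most $d$ and with $d_{EM}(D,D_0)\le\beta$. A non-adaptive learner over $\{0,1\}^n$ with sample complexity $s$ and query complexity $q$ is a randomized procedure that first tosses (finitely valued) random coins and, depending on them alone, chooses sets $J_1,\dots,J_s\subseteq[n]$ with $\sum_i|J_i|\le q$; it then takes $s$ independent samples $V_1,\dots,V_s$ from the unknown distribution $D$ (independent of the coins), queries the coordinates of $V_i$ in $J_i$ for each $i$, and outputs, as a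 function of the coins and of the answers $V_1|_{J_1},\dots,V_s|_{J_s}$ only, either a full description of a distribution on $\{0,1\}^n$ or Fail. **Theorem.** Let $d\in\mathbb N$ (with $d=0$ allowed). There are functions $s,q$ of $(\alpha,\beta)$ (depending on $d$ but not on $n$ or $D$), and for all $n$, $\alpha$, $\beta$ a non-adaptive learner $A_{n,\alpha,\beta}$ over $\{0,1\}^n$ with sample complexity $s(\alpha,\beta)$ and query complexity $q(\alpha,\beta)$, such that for all $\alpha,\beta\in(0,1)$ with $\beta<\alpha$ and $\varepsilon:=17(3\alpha+\beta/\alpha)<1$, all $n\ge1$ and every distribution $D$ on $\{0,1\}^n$, the learner $A_{n,\alpha,\beta}$ run on $D$ satisfies both of the following. 1. If $D$ is $\beta$-close to VC-dimension $d$, then with probability at least $2/3$ it outputs a distribution $D'$ such that $d_{EM}(D,D'_\sigma)\le\varepsilon$ for some permutation $\sigma$ of $[n]$. 2. For every $D$ (whether or not it is $\beta$-close to VC-dimension $d$), the probability that it outputs a distribution $D'$ with $d_{EM}(D,D'_\sigma)>\varepsilon$ for every permutation $\sigma$ of $[n]$ is at most $1/3$. (If $D$ is not $\beta$-close to VC-dimension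 $d$, it may output Fail with any probability.) -/

import Mathlib

namespace HugeObject

/-- The Hamming cube `{0,1}^n`. -/
abbrev Cube (n : ℕ) : Type := Fin n → Bool

/-- The normalized Hamming distance on `{0,1}^n`. -/
noncomputable def dH {n : ℕ} (X Y : Cube n) : ℝ := (hammingDist X Y : ℝ) / n

/-- Feasible points of the transportation linear program between two distributions on the cube:
`f X Y` is the mass moved from `X` to `Y`. -/
structure IsFlow {n : ℕ} (D₁ D₂ : PMF (Cube n)) (f : Cube n → Cube n → ℝ) : Prop where
  nonneg : ∀ X Y, 0 ≤ f X Y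
  le_one : ∀ X Y, f X Y ≤ 1
  sum_right : ∀ X, ∑ Y, f X Y = (D₁ X).toReal
  sum_left : ∀ Y, ∑ X, f X Y = (D₂ Y).toReal

/-- The Earth Mover Distance: the value of the transportation linear program with cost `dH`.
The feasible set is compact and contains the product flow `D₁ X * D₂ Y`, so that the infimum is
a minimum. -/
noncomputable def emd {n : ℕ} (D₁ D₂ : PMF (Cube n)) : ℝ :=
  sInf {c : ℝ | ∃ f, IsFlow D₁ D₂ f ∧ c = ∑ X, ∑ Y, f X Y * dH X Y}

/-- The index-permuted distribution `D_σ`, that is,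
`D_σ (w_{σ(1)}, …, w_{σ(n)}) = D (w_1, …, w_n)`. -/
noncomputable def permute {n : ℕ} (σ : Equiv.Perm (Fin n)) (D : PMF (Cube n)) : PMF (Cube n) :=
  D.map fun w i => w (σ i)

/-- The support of a distribution on the cube, as a family of subsets of the index set: a vector
is identified with the set of the indices at which it is `1`. -/
noncomputable def supportFamily {n : ℕ} (D : PMF (Cube n)) : Finset (Finset (Fin n)) :=
  open Classical in
  (Finset.univ.filter fun v : Cube n => v ∈ D.support).image
    fun v => Finset.univ.filter fun i => v i = true

/-- The support of `D` has VC-dimension at most `d`. -/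
def HasVCDimAtMost {n : ℕ} (D : PMF (Cube n)) (d : ℕ) : Prop :=
  (supportFamily D).vcDim ≤ d

/-- `D` is `β`-close in Earth Mover Distance to VC-dimension (at most) `d`. -/
def IsCloseToVCDim {n : ℕ} (D : PMF (Cube n)) (β : ℝ) (d : ℕ) : Prop :=
  ∃ D₀ : PMF (Cube n), HasVCDimAtMost D₀ d ∧ emd D D₀ ≤ β

/-- The law of `s` independent samples from `D`. -/
noncomputable def iidSamples {n : ℕ} (s : ℕ) (D : PMF (Cube n)) : PMF (Fin s → Cube n) :=
  PMF.ofFintype (fun V => ∏ i, D (V i)) <| by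
    rw [← Fintype.prod_sum fun (_ : Fin s) (v : Cube n) => D v]
    have h : ∑ v, D v = 1 := by rw [← tsum_fintype (L := .unconditional _)]; exact D.tsum_coe
    simp [h]

/-- A non-adaptive learner over `{0,1}^n` with sample complexity `s` and query complexity `q`.
It tosses its coins; these alone determine the sets `querySet c 0, …, querySet c (s - 1)` of
indices to be queried in the `s` samples, at most `q` queries in total. Its output, which is the
full description of a distribution or `none` (for FAIL), is a function of the coins and of
the answers to these queries. -/
structure NonAdaptiveLearner (n s q : ℕ) where
  Coins : Type
  finite_coins : Finite Coins
  coins : PMF Coins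
  querySet : Coins → Fin s → Finset (Fin n)
  card_le : ∀ c, ∑ i, (querySet c i).card ≤ q
  output : (c : Coins) → ((i : Fin s) → {j // j ∈ querySet c i} → Bool) → Option (PMF (Cube n))

/-- The law of the output of a learner when the unknown distribution is `D`: the samples are
drawn independently of one another and of the coins. -/
noncomputable def NonAdaptiveLearner.run {n s q : ℕ} (A : NonAdaptiveLearner n s q)
    (D : PMF (Cube n)) : PMF (Option (PMF (Cube n))) :=
  A.coins.bind fun c => (iidSamples s D).map fun V => A.output c fun i j => V i j.1

/-- The probability of the event `E` under the law `p`. -/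
noncomputable def prob {Ω : Type*} (p : PMF Ω) (E : Set Ω) : ENNReal := p.toOuterMeasure E

end HugeObject

open HugeObject

/-!
The learner queries the same `k` random indices in each of `s + r` samples. The column of an index
is the vector of its values in all the samples. There are only `2 ^ (s + r)` possible columns, so
that for `k` large the statistics of the queried columns are close in `ℓ¹` to those of all `n`
columns (`iidMean_colDiscrepancy_le`). Rows that have the best fitting column statistics are then,
up to one common permutation of the indices, close to the samples themselves
(`exists_perm_dH_reconstruct_le`). In this way the learner knows its samples completely, up to a
small error and a permutation.

It uses the first `s` samples `V` as centres and the other `r` samples `U` as tests. If the mean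
distance of the tests to the nearest centres is small, it outputs the uniform distribution on the
tests, and otherwise it fails.

Whatever `D` is, a list of tests with `r` large compared to `s` represents the mean distance of `D`
to the centres and the masses of the Voronoi cells of the centres
(`iidMean_sampleDeviation_append_le`). If moreover the tests are close to the centres, moving `D` to
the centres, adjusting the masses of the cells, and moving back to the tests is cheap
(`transport_map_uniform`). Hence an accepted output is correct with high probability
(`emd_le_of_clusterOutput_eq_some`).

If `D` is close to a distribution whose support has bounded VC-dimension, then rounding to a net, of
size bounded by Dudley's packing argument and the Sauer-Shelah lemma (`exists_packing_bound`), shows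
that `D` is close to a distribution with boundedly many atoms. Each atom `z` that receives the mass
`m` at cost `c` has a sample within `2 * c / m` unless all samples miss a set of mass at least
`m / 2` (`mul_iidMean_dH_nearest_le`). Summed over the atoms, this bounds the mean distance of the
tests to the centres (`iidMean_quantError_le`), and Markov's inequality shows that the learner is
unlikely to fail.
-/

namespace HugeObject

/-! ### Nets in families of bounded VC-dimension -/

section Packing

variable {ι : Type*} [DecidableEq ι]

/-- A form of the Sauer-Shelah lemma in which only the union of the family has to be small, and not
the ground type. -/
theorem card_le_of_vcDim_le {𝒜 : Finset (Finset ι)} {S : Finset ι} {d : ℕ}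
    (hS : ∀ A ∈ 𝒜, A ⊆ S) (hd : 𝒜.vcDim ≤ d) : 𝒜.card ≤ (d + 1) * (S.card + 1) ^ d := by
  calc 𝒜.card ≤ 𝒜.shatterer.card := 𝒜.card_le_card_shatterer
    _ ≤ ((Finset.range (d + 1)).biUnion fun i => S.powersetCard i).card := by
        refine Finset.card_le_card fun T hT => ?_
        rw [Finset.mem_shatterer] at hT
        obtain ⟨A, hA, hTA⟩ := hT.exists_superset
        simp only [Finset.mem_biUnion, Finset.mem_range, Finset.mem_powersetCard]
        exact ⟨T.card, Nat.lt_succ_of_le (hT.card_le_vcDim.trans hd), hTA.trans (hS A hA), rfl⟩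
    _ ≤ ∑ i ∈ Finset.range (d + 1), (S.powersetCard i).card := Finset.card_biUnion_le
    _ ≤ ∑ _i ∈ Finset.range (d + 1), (S.card + 1) ^ d := by
        refine Finset.sum_le_sum fun i hi => ?_
        rw [Finset.card_powersetCard]
        calc S.card.choose i ≤ S.card ^ i := Nat.choose_le_pow _ _
          _ ≤ (S.card + 1) ^ i := Nat.pow_le_pow_left (Nat.le_succ _) _
          _ ≤ (S.card + 1) ^ d :=
              Nat.pow_le_pow_right (Nat.succ_pos _) (Nat.lt_succ_iff.1 (Finset.mem_range.1 hi))
    _ = (d + 1) * (S.card + 1) ^ d := by simp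

theorem vcDim_image_inter_le (𝒜 : Finset (Finset ι)) (S : Finset ι) :
    (𝒜.image (· ∩ S)).vcDim ≤ 𝒜.vcDim := by
  refine Finset.sup_le fun T hT => ?_
  rw [Finset.mem_shatterer] at hT
  have hTS : T ⊆ S := by
    obtain ⟨B, hB, hTB⟩ := hT.exists_superset
    obtain ⟨A, -, rfl⟩ := Finset.mem_image.1 hB
    exact hTB.trans Finset.inter_subset_right
  refine Finset.Shatters.card_le_vcDim fun U hU => ?_
  obtain ⟨B, hB, rfl⟩ := hT hU
  obtain ⟨A, hA, rfl⟩ := Finset.mem_image.1 hB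
  refine ⟨A, hA, ?_⟩
  ext i
  simp only [Finset.mem_inter]
  exact ⟨fun h => ⟨h.1, h.2, hTS h.1⟩, fun h => ⟨h.1, h.2.1⟩⟩

end Packing

variable {n : ℕ}

theorem dH_nonneg (X Y : Cube n) : 0 ≤ dH X Y := by unfold dH; positivity

theorem dH_self (X : Cube n) : dH X X = 0 := by simp [dH]

theorem dH_comm (X Y : Cube n) : dH X Y = dH Y X := by simp [dH, hammingDist_comm]

theorem dH_triangle (X Y Z : Cube n) : dH X Z ≤ dH X Y + dH Y Z := by
  unfold dH
  rw [← add_div]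
  gcongr
  exact_mod_cast hammingDist_triangle X Y Z

theorem dH_le_one (X Y : Cube n) : dH X Y ≤ 1 := by
  unfold dH
  refine div_le_one_of_le₀ ?_ (by positivity)
  exact_mod_cast (hammingDist_le_card_fintype (x := X) (y := Y)).trans (by simp)

theorem dH_mul_card (hn : 0 < n) (X Y : Cube n) :
    dH X Y * n = ((Finset.univ.filter fun i => X i ≠ Y i).card : ℝ) := by
  have : (n : ℝ) ≠ 0 := by positivity
  simp [dH, hammingDist, this]

theorem dH_comp_perm (σ : Equiv.Perm (Fin n)) (X Y : Cube n) :
    dH (fun i => X (σ i)) (fun i => Y (σ i)) = dH X Y := by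
  unfold dH hammingDist
  congr 2
  refine Finset.card_bij (fun i _ => σ i) (by simp) (by simp) fun i hi => ?_
  exact ⟨σ.symm i, by simpa using hi, by simp⟩

/-- A random tuple of `k` indices distinguishes any two vectors at distance more than `δ`, except
with probability `(1 - δ) ^ k`; hence one tuple distinguishes all pairs from a small family. -/
theorem exists_separating_indices (hn : 0 < n) {δ : ℝ} (hδ : δ ≤ 1) {k : ℕ} {M : Finset (Cube n)}
    (hM : ∀ x ∈ M, ∀ y ∈ M, x ≠ y → δ < dH x y) (hk : (M.card : ℝ) ^ 2 * (1 - δ) ^ k < 1) :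
    ∃ K : Fin k → Fin n, ∀ x ∈ M, ∀ y ∈ M, (∀ l, x (K l) = y (K l)) → x = y := by
  classical
  by_contra! hcon
  have hn' : (0 : ℝ) < n := by exact_mod_cast hn
  have hcover : (Finset.univ : Finset (Fin k → Fin n)) ⊆ M.offDiag.biUnion fun p =>
      Fintype.piFinset fun _ => Finset.univ.filter fun i => p.1 i = p.2 i := by
    intro K _
    obtain ⟨x, hx, y, hy, hK, hxy⟩ := hcon K
    simp only [Finset.mem_biUnion, Finset.mem_offDiag, Fintype.mem_piFinset, Finset.mem_filter]
    exact ⟨(x, y), ⟨hx, hy, hxy⟩, fun l => ⟨Finset.mem_univ _, hK l⟩⟩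
  have hcard := (Finset.card_le_card hcover).trans Finset.card_biUnion_le
  have hpair : ∀ p ∈ M.offDiag, ((Fintype.piFinset fun _ : Fin k =>
      Finset.univ.filter fun i => p.1 i = p.2 i).card : ℝ) ≤ ((1 - δ) * n) ^ k := by
    intro p hp
    rw [Finset.mem_offDiag] at hp
    rw [Fintype.card_piFinset_const]
    push_cast
    refine pow_le_pow_left₀ (by positivity) ?_ k
    have h1 := dH_mul_card hn p.1 p.2
    have h2 := hM p.1 hp.1 p.2 hp.2.1 hp.2.2
    have h3 : ((Finset.univ.filter fun i => p.1 i = p.2 i).card : ℝ) +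
        (Finset.univ.filter fun i => p.1 i ≠ p.2 i).card = n := by
      exact_mod_cast (Finset.card_filter_add_card_filter_not _).trans (by simp)
    nlinarith
  have hsum : (n : ℝ) ^ k ≤ M.offDiag.card * ((1 - δ) * n) ^ k := by
    calc (n : ℝ) ^ k = ((Finset.univ : Finset (Fin k → Fin n)).card : ℝ) := by simp
      _ ≤ ∑ p ∈ M.offDiag, ((Fintype.piFinset fun _ : Fin k =>
            Finset.univ.filter fun i => p.1 i = p.2 i).card : ℝ) := by exact_mod_cast hcard
      _ ≤ ∑ _p ∈ M.offDiag, ((1 - δ) * n) ^ k := Finset.sum_le_sum hpair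
      _ = _ := by simp
  have hoff : (M.offDiag.card : ℝ) ≤ (M.card : ℝ) ^ 2 := by
    rw [Finset.offDiag_card, sq]
    exact_mod_cast Nat.sub_le _ _
  have h0 : (0 : ℝ) ≤ (1 - δ) ^ k := pow_nonneg (by linarith) k
  rw [mul_pow] at hsum
  have hnk : (0 : ℝ) < (n : ℝ) ^ k := by positivity
  have : (M.offDiag.card : ℝ) * (1 - δ) ^ k < 1 :=
    (mul_le_mul_of_nonneg_right hoff h0).trans_lt hk
  nlinarith

/-- The set of the indices at which a vector is `1`. -/
def ones (v : Cube n) : Finset (Fin n) := Finset.univ.filter fun i => v i = true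

theorem mem_ones {v : Cube n} {i : Fin n} : i ∈ ones v ↔ v i = true := by simp [ones]

theorem ones_mem_supportFamily {D : PMF (Cube n)} {v : Cube n} (hv : v ∈ D.support) :
    ones v ∈ supportFamily D := by
  classical
  unfold supportFamily
  exact Finset.mem_image.2 ⟨v, by simpa using hv, by simp [ones]⟩

/-- The number of vectors whose restrictions to `k` indices are distinct is bounded in terms of
`k` and the VC-dimension. -/
theorem card_le_of_separating_indices {D : PMF (Cube n)} {d k : ℕ} (hD : HasVCDimAtMost D d)
    {M : Finset (Cube n)} (hMD : ∀ v ∈ M, v ∈ D.support) {K : Fin k → Fin n}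
    (hK : ∀ x ∈ M, ∀ y ∈ M, (∀ l, x (K l) = y (K l)) → x = y) :
    M.card ≤ (d + 1) * (k + 1) ^ d := by
  classical
  set S : Finset (Fin n) := Finset.univ.image K
  have hSk : S.card ≤ k := Finset.card_image_le.trans (by simp)
  set 𝒜 : Finset (Finset (Fin n)) := M.image ones
  have h𝒜 : 𝒜 ⊆ supportFamily D := by
    intro A hA
    obtain ⟨v, hv, rfl⟩ := Finset.mem_image.1 hA
    exact ones_mem_supportFamily (hMD v hv)
  have hinj : Set.InjOn ((· ∩ S) ∘ ones) (M : Set (Cube n)) := by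
    intro x hx y hy hxy
    refine hK x hx y hy fun l => ?_
    have hl : K l ∈ S := Finset.mem_image_of_mem K (Finset.mem_univ l)
    have h : K l ∈ ones x ∩ S ↔ K l ∈ ones y ∩ S := by
      simp only [Function.comp_apply] at hxy
      rw [hxy]
    simp only [Finset.mem_inter, hl, and_true, mem_ones] at h
    exact Bool.eq_iff_iff.2 h
  calc M.card = (𝒜.image (· ∩ S)).card := by
        rw [Finset.image_image, Finset.card_image_of_injOn hinj]
    _ ≤ (d + 1) * (S.card + 1) ^ d := by
        refine card_le_of_vcDim_le (S := S) (fun A hA => ?_)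
          (((vcDim_image_inter_le 𝒜 S).trans (Finset.vcDim_mono h𝒜)).trans hD)
        obtain ⟨B, -, rfl⟩ := Finset.mem_image.1 hA
        exact Finset.inter_subset_right
    _ ≤ (d + 1) * (k + 1) ^ d := by gcongr

theorem exists_pow_mul_pow_lt_one (d : ℕ) {r : ℝ} (hr0 : 0 < r) (hr1 : r < 1) :
    ∃ k : ℕ, (((d + 1) * (k + 1) ^ d + 1 : ℕ) : ℝ) ^ 2 * r ^ k < 1 := by
  have ht := (tendsto_pow_const_mul_const_pow_of_abs_lt_one (2 * d)
    (by rwa [abs_of_pos hr0] : |r| < 1)).comp (Filter.tendsto_add_atTop_nat 1)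
  have hpos : (0 : ℝ) < r / (d + 2) ^ 2 := by positivity
  obtain ⟨k, hk⟩ := (ht.eventually (gt_mem_nhds hpos)).exists
  refine ⟨k, ?_⟩
  simp only [Function.comp_apply, Nat.cast_add, Nat.cast_one] at hk
  rw [lt_div_iff₀ (by positivity), pow_succ] at hk
  have h1 : (((d + 1) * (k + 1) ^ d + 1 : ℕ) : ℝ) ≤ (d + 2) * ((k : ℝ) + 1) ^ d := by
    push_cast
    have : (1 : ℝ) ≤ ((k : ℝ) + 1) ^ d :=
      one_le_pow₀ (by linarith [(Nat.cast_nonneg k : (0 : ℝ) ≤ k)])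
    linarith
  have h2 : (((d + 1) * (k + 1) ^ d + 1 : ℕ) : ℝ) ^ 2 * r ^ k ≤
      ((d + 2) * ((k : ℝ) + 1) ^ d) ^ 2 * r ^ k := by gcongr
  refine h2.trans_lt ?_
  have h3 : ((k : ℝ) + 1) ^ (2 * d) * (r ^ k * r) * (d + 2) ^ 2 =
      r * (((d + 2) * ((k : ℝ) + 1) ^ d) ^ 2 * r ^ k) := by
    rw [mul_comm 2 d, pow_mul]; ring
  rw [h3] at hk
  by_contra! hcon
  nlinarith

/-- Dudley's packing argument: the size of a `δ`-separated set in the support is bounded in terms of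
`δ` and the VC-dimension alone. Were the set larger than the number of traces on `k` indices, with
`k` chosen so that some `k` indices separate the set, this would contradict Sauer-Shelah. -/
theorem exists_packing_bound (d : ℕ) {δ : ℝ} (hδ0 : 0 < δ) (hδ1 : δ < 1) :
    ∃ m : ℕ, ∀ n : ℕ, 0 < n → ∀ D : PMF (Cube n), HasVCDimAtMost D d →
      ∀ M : Finset (Cube n), (∀ v ∈ M, v ∈ D.support) →
        (∀ x ∈ M, ∀ y ∈ M, x ≠ y → δ < dH x y) → M.card ≤ m := by
  obtain ⟨k, hk⟩ := exists_pow_mul_pow_lt_one d (r := 1 - δ) (by linarith) (by linarith)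
  refine ⟨(d + 1) * (k + 1) ^ d, fun n hn D hD M hMD hM => ?_⟩
  by_contra! hcon
  obtain ⟨M', hM'M, hM'⟩ := Finset.exists_subset_card_eq (Nat.succ_le_of_lt hcon)
  obtain ⟨K, hK⟩ := exists_separating_indices hn hδ1.le (k := k) (M := M')
    (fun x hx y hy => hM x (hM'M hx) y (hM'M hy)) (by rw [hM']; exact hk)
  have := card_le_of_separating_indices hD (fun v hv => hMD v (hM'M hv)) hK
  omega

/-- A maximal separated subset of the support is a net. -/
theorem exists_net (d : ℕ) {δ : ℝ} (hδ0 : 0 < δ) (hδ1 : δ < 1) :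
    ∃ m : ℕ, ∀ n : ℕ, 0 < n → ∀ D : PMF (Cube n), HasVCDimAtMost D d →
      ∃ M : Finset (Cube n), M.card ≤ m ∧ ∀ v ∈ D.support, ∃ z ∈ M, dH v z ≤ δ := by
  classical
  obtain ⟨m, hm⟩ := exists_packing_bound d hδ0 hδ1
  refine ⟨m, fun n hn D hD => ?_⟩
  set P : Finset (Cube n) → Prop := fun M =>
    (∀ v ∈ M, v ∈ D.support) ∧ ∀ x ∈ M, ∀ y ∈ M, x ≠ y → δ < dH x y
  obtain ⟨M, hM, hmax⟩ := Finset.exists_max_image (Finset.univ.filter P) Finset.card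
    ⟨∅, by simp [P]⟩
  simp only [Finset.mem_filter, Finset.mem_univ, true_and] at hM hmax
  refine ⟨M, hm n hn D hD M hM.1 hM.2, fun v hv => ?_⟩
  by_contra! hcon
  have hvM : v ∉ M := fun h => by have := hcon v h; rw [dH_self] at this; linarith
  have hP : P (insert v M) := by
    refine ⟨fun w hw => ?_, fun x hx y hy hxy => ?_⟩
    · rcases Finset.mem_insert.1 hw with rfl | hw
      exacts [hv, hM.1 w hw]
    · rcases Finset.mem_insert.1 hx with hxv | hxM <;>
        rcases Finset.mem_insert.1 hy with hyv | hyM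
      · exact absurd (hxv.trans hyv.symm) hxy
      · exact hxv ▸ hcon y hyM
      · rw [dH_comm]
        exact hyv ▸ hcon x hxM
      · exact hM.2 x hxM y hyM hxy
  have := hmax _ hP
  rw [Finset.card_insert_of_notMem hvM] at this
  omega

/-! ### Transport between distributions on the cube -/

theorem sum_toReal {Ω : Type*} [Fintype Ω] (D : PMF Ω) : ∑ v, (D v).toReal = 1 := by
  rw [← ENNReal.toReal_sum fun v _ => D.apply_ne_top v, ← tsum_fintype (L := .unconditional _),
    D.tsum_coe, ENNReal.toReal_one]

/-- The mass of `D₁` can be moved onto `D₂` at cost at most `c`. -/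
def Transport (D₁ D₂ : PMF (Cube n)) (c : ℝ) : Prop :=
  ∃ f, IsFlow D₁ D₂ f ∧ ∑ X, ∑ Y, f X Y * dH X Y ≤ c

/-- The upper bound `1` on the entries of a flow follows from the other conditions. -/
theorem isFlow_of_sum {D₁ D₂ : PMF (Cube n)} {f : Cube n → Cube n → ℝ} (h0 : ∀ X Y, 0 ≤ f X Y)
    (h1 : ∀ X, ∑ Y, f X Y = (D₁ X).toReal) (h2 : ∀ Y, ∑ X, f X Y = (D₂ Y).toReal) :
    IsFlow D₁ D₂ f where
  nonneg := h0
  sum_right := h1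
  sum_left := h2
  le_one X Y := by
    calc f X Y ≤ ∑ Y, f X Y := Finset.single_le_sum (fun Y _ => h0 X Y) (Finset.mem_univ Y)
      _ = (D₁ X).toReal := h1 X
      _ ≤ 1 := ENNReal.toReal_le_of_le_ofReal zero_le_one (by simpa using D₁.coe_le_one X)

theorem Transport.emd_le {D₁ D₂ : PMF (Cube n)} {c : ℝ} (h : Transport D₁ D₂ c) :
    emd D₁ D₂ ≤ c := by
  obtain ⟨f, hf, hc⟩ := h
  unfold emd
  refine le_trans (csInf_le ⟨0, ?_⟩ ⟨f, hf, rfl⟩) hc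
  rintro _ ⟨g, hg, rfl⟩
  exact Finset.sum_nonneg fun X _ => Finset.sum_nonneg fun Y _ =>
    mul_nonneg (hg.nonneg X Y) (dH_nonneg X Y)

theorem transport_of_emd_lt {D₁ D₂ : PMF (Cube n)} {c : ℝ} (h : emd D₁ D₂ < c) :
    Transport D₁ D₂ c := by
  have hprod : IsFlow D₁ D₂ fun X Y => (D₁ X).toReal * (D₂ Y).toReal := by
    refine isFlow_of_sum (fun X Y => by positivity) (fun X => ?_) fun Y => ?_
    · rw [← Finset.mul_sum, sum_toReal, mul_one]
    · rw [← Finset.sum_mul, sum_toReal, one_mul]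
  unfold emd at h
  obtain ⟨_, ⟨f, hf, rfl⟩, hc⟩ := exists_lt_of_csInf_lt (by exact ⟨_, _, hprod, rfl⟩) h
  exact ⟨f, hf, hc.le⟩

/-- Gluing of flows along the middle distribution. -/
theorem Transport.trans {D₁ D₂ D₃ : PMF (Cube n)} {c c' : ℝ} (h : Transport D₁ D₂ c)
    (h' : Transport D₂ D₃ c') : Transport D₁ D₃ (c + c') := by
  obtain ⟨f, hf, hc⟩ := h
  obtain ⟨g, hg, hc'⟩ := h'
  set q : Cube n → ℝ := fun Y => (D₂ Y).toReal with hq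
  have hf0 : ∀ X Y, q Y = 0 → f X Y = 0 := fun X Y h0 => by
    have := hf.sum_left Y
    exact (Finset.sum_eq_zero_iff_of_nonneg fun X _ => hf.nonneg X Y).1 (this.trans h0) X
      (Finset.mem_univ X)
  have hg0 : ∀ Y Z, q Y = 0 → g Y Z = 0 := fun Y Z h0 => by
    have := hg.sum_right Y
    exact (Finset.sum_eq_zero_iff_of_nonneg fun Z _ => hg.nonneg Y Z).1 (this.trans h0) Z
      (Finset.mem_univ Z)
  -- The glued mass moved along `X → Y → Z`; it vanishes by `x / 0 = 0` where `q Y = 0`.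
  set w : Cube n → Cube n → Cube n → ℝ := fun X Y Z => f X Y * g Y Z / q Y with hw
  have hw0 : ∀ X Y Z, 0 ≤ w X Y Z := fun X Y Z =>
    div_nonneg (mul_nonneg (hf.nonneg X Y) (hg.nonneg Y Z)) ENNReal.toReal_nonneg
  have hwZ : ∀ X Y, ∑ Z, w X Y Z = f X Y := fun X Y => by
    rw [hw, ← Finset.sum_div, ← Finset.mul_sum, hg.sum_right]
    rcases eq_or_ne (q Y) 0 with h0 | h0
    · rw [hf0 X Y h0]; simp
    · exact mul_div_cancel_right₀ _ h0
  have hwX : ∀ Y Z, ∑ X, w X Y Z = g Y Z := fun Y Z => by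
    rw [hw, ← Finset.sum_div, ← Finset.sum_mul, hf.sum_left]
    rcases eq_or_ne (q Y) 0 with h0 | h0
    · rw [hg0 Y Z h0]; simp
    · exact mul_div_cancel_left₀ _ h0
  refine ⟨fun X Z => ∑ Y, w X Y Z, isFlow_of_sum (fun X Z => Finset.sum_nonneg fun Y _ => hw0 X Y Z)
    (fun X => ?_) fun Z => ?_, ?_⟩
  · rw [Finset.sum_comm]
    simp_rw [hwZ]
    exact hf.sum_right X
  · rw [Finset.sum_comm]
    simp_rw [hwX]
    exact hg.sum_left Z
  · calc ∑ X, ∑ Z, (∑ Y, w X Y Z) * dH X Z = ∑ X, ∑ Z, ∑ Y, w X Y Z * dH X Z := by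
          simp_rw [Finset.sum_mul]
      _ ≤ ∑ X, ∑ Z, ∑ Y, (w X Y Z * dH X Y + w X Y Z * dH Y Z) := by
          refine Finset.sum_le_sum fun X _ => Finset.sum_le_sum fun Z _ =>
            Finset.sum_le_sum fun Y _ => ?_
          rw [← mul_add]
          exact mul_le_mul_of_nonneg_left (dH_triangle X Y Z) (hw0 X Y Z)
      _ = (∑ X, ∑ Z, ∑ Y, w X Y Z * dH X Y) + ∑ X, ∑ Z, ∑ Y, w X Y Z * dH Y Z := by
          simp_rw [Finset.sum_add_distrib]
      _ = (∑ X, ∑ Y, f X Y * dH X Y) + ∑ Y, ∑ Z, g Y Z * dH Y Z := by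
          congr 1
          · refine Finset.sum_congr rfl fun X _ => ?_
            rw [Finset.sum_comm]
            refine Finset.sum_congr rfl fun Y _ => ?_
            rw [← Finset.sum_mul, hwZ]
          · rw [Finset.sum_comm]
            calc _ = ∑ Z, ∑ Y, ∑ X, w X Y Z * dH Y Z :=
                  Finset.sum_congr rfl fun Z _ => Finset.sum_comm
              _ = ∑ Z, ∑ Y, g Y Z * dH Y Z := by simp_rw [← Finset.sum_mul, hwX]
              _ = _ := Finset.sum_comm
      _ ≤ c + c' := add_le_add hc hc'

theorem map_apply_toReal {Ω Ω' : Type*} [Fintype Ω] [DecidableEq Ω'] (ρ : PMF Ω)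
    (b : Ω → Ω') (y : Ω') : (ρ.map b y).toReal = ∑ u, if y = b u then (ρ u).toReal else 0 := by
  classical
  rw [PMF.map_apply, tsum_fintype, ENNReal.toReal_sum fun u _ => by
    split_ifs <;> simp [ρ.apply_ne_top]]
  refine Finset.sum_congr rfl fun u _ => ?_
  split_ifs <;> simp

theorem transport_map_map {Ω : Type*} [Fintype Ω] (ρ : PMF Ω) (b b' : Ω → Cube n) :
    Transport (ρ.map b) (ρ.map b') (∑ u, (ρ u).toReal * dH (b u) (b' u)) := by
  refine ⟨fun X Y => ∑ u, if X = b u then if Y = b' u then (ρ u).toReal else 0 else 0,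
    isFlow_of_sum (fun X Y => Finset.sum_nonneg fun u _ => by split_ifs <;> simp)
      (fun X => ?_) fun Y => ?_, le_of_eq ?_⟩
  · rw [Finset.sum_comm, map_apply_toReal]
    refine Finset.sum_congr rfl fun u _ => ?_
    split_ifs <;> simp
  · rw [Finset.sum_comm, map_apply_toReal]
    refine Finset.sum_congr rfl fun u _ => ?_
    simp
  · simp_rw [Finset.sum_mul]
    rw [Finset.sum_congr rfl fun X _ => Finset.sum_comm, Finset.sum_comm]
    refine Finset.sum_congr rfl fun u _ => ?_
    simp [ite_mul]

/-- Leave in place the mass that the two distributions have in common, and move the rest in an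
arbitrary way, over a distance of at most `1`. -/
theorem transport_of_sum_abs_sub (D₁ D₂ : PMF (Cube n)) :
    Transport D₁ D₂ (∑ X, |(D₁ X).toReal - (D₂ X).toReal|) := by
  classical
  set p : Cube n → ℝ := fun X => (D₁ X).toReal with hp
  set q : Cube n → ℝ := fun X => (D₂ X).toReal with hq
  set a : Cube n → ℝ := fun X => p X - min (p X) (q X) with ha
  set b : Cube n → ℝ := fun X => q X - min (p X) (q X) with hb
  have ha0 : ∀ X, 0 ≤ a X := fun X => sub_nonneg.2 (min_le_left _ _)
  have hb0 : ∀ X, 0 ≤ b X := fun X => sub_nonneg.2 (min_le_right _ _)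
  set τ : ℝ := ∑ X, a X with hτ
  have hτb : ∑ X, b X = τ := by
    have h1 : ∑ X, p X = 1 := sum_toReal D₁
    have h2 : ∑ X, q X = 1 := sum_toReal D₂
    simp only [hτ, ha, hb, Finset.sum_sub_distrib, h1, h2]
  have hτ0 : 0 ≤ τ := Finset.sum_nonneg fun X _ => ha0 X
  have hcancel : ∀ x : ℝ, (τ = 0 → x = 0) → x * τ / τ = x := fun x hx => by
    rcases eq_or_ne τ 0 with h | h
    · rw [hx h]; simp
    · exact mul_div_cancel_right₀ _ h
  have haτ : ∀ X, τ = 0 → a X = 0 := fun X h =>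
    (Finset.sum_eq_zero_iff_of_nonneg fun X _ => ha0 X).1 (hτ ▸ h) X (Finset.mem_univ X)
  have hbτ : ∀ X, τ = 0 → b X = 0 := fun X h =>
    (Finset.sum_eq_zero_iff_of_nonneg fun X _ => hb0 X).1 (hτb ▸ h) X (Finset.mem_univ X)
  refine ⟨fun X Y => (if X = Y then min (p X) (q X) else 0) + a X * b Y / τ,
    isFlow_of_sum (fun X Y => ?_) (fun X => ?_) fun Y => ?_, ?_⟩
  · refine add_nonneg ?_ (div_nonneg (mul_nonneg (ha0 X) (hb0 Y)) hτ0)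
    split_ifs
    exacts [le_min ENNReal.toReal_nonneg ENNReal.toReal_nonneg, le_rfl]
  · rw [Finset.sum_add_distrib, ← Finset.sum_div, ← Finset.mul_sum, hτb, hcancel _ (haτ X)]
    simp [ha, hp]
  · rw [Finset.sum_add_distrib, ← Finset.sum_div, ← Finset.sum_mul, ← hτ, mul_comm τ,
      hcancel _ (hbτ Y)]
    simp [hb, hq]
  · calc ∑ X, ∑ Y, ((if X = Y then min (p X) (q X) else 0) + a X * b Y / τ) * dH X Y
        ≤ ∑ X, ∑ Y, a X * b Y / τ := by
          refine Finset.sum_le_sum fun X _ => Finset.sum_le_sum fun Y _ => ?_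
          have h0 : 0 ≤ a X * b Y / τ := div_nonneg (mul_nonneg (ha0 X) (hb0 Y)) hτ0
          rcases eq_or_ne X Y with rfl | h
          · rw [dH_self, mul_zero]; exact h0
          · rw [if_neg h, zero_add]
            exact mul_le_of_le_one_right h0 (dH_le_one X Y)
      _ = ∑ X, a X := by
          refine Finset.sum_congr rfl fun X _ => ?_
          rw [← Finset.sum_div, ← Finset.mul_sum, hτb, hcancel _ (haτ X)]
      _ ≤ ∑ X, |p X - q X| := by
          refine Finset.sum_le_sum fun X _ => ?_
          simp only [ha]
          rcases min_cases (p X) (q X) with h | h <;> rw [h.1]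
          · simp
          · exact le_abs_self _

/-! ### Means over independent samples -/

section IidMean

variable {Ω : Type*} [Fintype Ω]

/-- The mean of `F` over `r` independent samples from the law with the weights `p`. -/
noncomputable def iidMean (p : Ω → ℝ) (r : ℕ) (F : (Fin r → Ω) → ℝ) : ℝ :=
  ∑ V, (∏ i, p (V i)) * F V

variable {p : Ω → ℝ} {r : ℕ} {F G : (Fin r → Ω) → ℝ}

theorem iidMean_mono (hp : ∀ u, 0 ≤ p u) (h : ∀ V, F V ≤ G V) :
    iidMean p r F ≤ iidMean p r G :=
  Finset.sum_le_sum fun V _ =>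
    mul_le_mul_of_nonneg_left (h V) (Finset.prod_nonneg fun i _ => hp (V i))

theorem iidMean_add : iidMean p r (fun V => F V + G V) = iidMean p r F + iidMean p r G := by
  simp [iidMean, mul_add, Finset.sum_add_distrib]

theorem iidMean_sum {κ : Type*} (s : Finset κ) (F : κ → (Fin r → Ω) → ℝ) :
    iidMean p r (fun V => ∑ j ∈ s, F j V) = ∑ j ∈ s, iidMean p r (F j) := by
  simp only [iidMean, Finset.mul_sum]
  exact Finset.sum_comm

theorem iidMean_mul_const (a : ℝ) :
    iidMean p r (fun V => F V * a) = iidMean p r F * a := by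
  simp [iidMean, Finset.sum_mul, mul_assoc]

theorem iidMean_div_const (a : ℝ) :
    iidMean p r (fun V => F V / a) = iidMean p r F / a := by
  simp only [div_eq_mul_inv, iidMean_mul_const]

theorem iidMean_prod (g : Ω → ℝ) :
    iidMean p r (fun V => ∏ i, g (V i)) = (∑ u, p u * g u) ^ r := by
  simp only [iidMean, ← Finset.prod_mul_distrib]
  rw [← Fintype.prod_sum fun (_ : Fin r) (u : Ω) => p u * g u]
  simp

theorem iidMean_one (hp : ∑ u, p u = 1) : iidMean p r (fun _ => 1) = 1 := by
  have := iidMean_prod (p := p) (r := r) fun _ => 1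
  simpa [hp] using this

theorem iidMean_const (hp : ∑ u, p u = 1) (a : ℝ) : iidMean p r (fun _ => a) = a := by
  have := iidMean_mul_const (p := p) (r := r) (F := fun _ => 1) a
  simpa [iidMean_one hp] using this

theorem iidMean_append (s : ℕ) (F : (Fin (s + r) → Ω) → ℝ) :
    iidMean p (s + r) F = iidMean p s fun V => iidMean p r fun U => F (Fin.append V U) := by
  simp only [iidMean, Finset.mul_sum]
  rw [← Fintype.sum_prod_type', ← (Fin.appendEquiv s r).sum_comp]
  refine Finset.sum_congr rfl fun x _ => ?_
  simp [Fin.appendEquiv, Fin.prod_univ_add, mul_assoc]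

theorem iidMean_succ (F : (Fin (r + 1) → Ω) → ℝ) :
    iidMean p (r + 1) F = ∑ v, p v * iidMean p r fun V => F (Fin.cons v V) := by
  simp only [iidMean, Finset.mul_sum]
  rw [← Fintype.sum_prod_type', ← (Fin.consEquiv fun _ => Ω).sum_comp]
  refine Finset.sum_congr rfl fun x _ => ?_
  simp [Fin.consEquiv, Fin.prod_univ_succ, mul_assoc]

theorem iidMean_sum_apply (hp : ∑ u, p u = 1) (g : Ω → ℝ) (r : ℕ) :
    iidMean p r (fun V => ∑ i, g (V i)) = r * ∑ u, p u * g u := by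
  induction r with
  | zero => simp [iidMean]
  | succ r ih =>
    rw [iidMean_succ]
    simp only [Fin.sum_univ_succ, Fin.cons_zero, Fin.cons_succ, iidMean_add, iidMean_const hp, ih,
      mul_add, Finset.sum_add_distrib, ← Finset.sum_mul, hp]
    push_cast
    ring

/-- The variance of a sum of independent centred variables is the sum of the variances. -/
theorem iidMean_sq_sum_apply (hp : ∑ u, p u = 1) {g : Ω → ℝ} (hg : ∑ u, p u * g u = 0) (r : ℕ) :
    iidMean p r (fun V => (∑ i, g (V i)) ^ 2) = r * ∑ u, p u * g u ^ 2 := by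
  induction r with
  | zero => simp [iidMean]
  | succ r ih =>
    rw [iidMean_succ]
    have hstep : ∀ v, iidMean p r (fun V => (∑ i, g ((Fin.cons v V : Fin (r + 1) → Ω) i)) ^ 2) =
        g v ^ 2 + r * ∑ u, p u * g u ^ 2 := fun v => by
      calc _ = iidMean p r fun V => (g v ^ 2 + (∑ i, g (V i)) * (2 * g v)) + (∑ i, g (V i)) ^ 2 := by
            congr 1
            ext V
            simp only [Fin.sum_univ_succ, Fin.cons_zero, Fin.cons_succ]
            ring
        _ = _ := by
            rw [iidMean_add, iidMean_add, iidMean_const hp, iidMean_mul_const,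
              iidMean_sum_apply hp, hg, ih]
            ring
    simp only [hstep, mul_add, Finset.sum_add_distrib, ← Finset.sum_mul, hp]
    push_cast
    ring

/-- The weak law of large numbers in mean, for functions with values in `[0, 1]`. -/
theorem iidMean_abs_sub_le (hp0 : ∀ u, 0 ≤ p u) (hp : ∑ u, p u = 1) {h : Ω → ℝ}
    (h0 : ∀ u, 0 ≤ h u) (h1 : ∀ u, h u ≤ 1) {η : ℝ} (hη : 0 < η) {r : ℕ}
    (hr : 1 / η ^ 2 ≤ r) :
    iidMean p r (fun V => |(∑ i, h (V i)) / r - ∑ u, p u * h u|) ≤ η := by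
  have hr0 : (0 : ℝ) < r := lt_of_lt_of_le (by positivity) hr
  set μ : ℝ := ∑ u, p u * h u with hμ
  have hμ0 : 0 ≤ μ := Finset.sum_nonneg fun u _ => mul_nonneg (hp0 u) (h0 u)
  have hμ1 : μ ≤ 1 := by
    calc μ ≤ ∑ u, p u := Finset.sum_le_sum fun u _ => mul_le_of_le_one_right (hp0 u) (h1 u)
      _ = 1 := hp
  have hcentred : ∑ u, p u * (h u - μ) = 0 := by
    simp only [mul_sub, Finset.sum_sub_distrib, ← Finset.sum_mul, hp]
    simp [hμ]
  have hvar : ∑ u, p u * (h u - μ) ^ 2 ≤ 1 := by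
    calc ∑ u, p u * (h u - μ) ^ 2 ≤ ∑ u, p u := by
          refine Finset.sum_le_sum fun u _ => mul_le_of_le_one_right (hp0 u) ?_
          rw [sq_le_one_iff_abs_le_one, abs_le]
          constructor <;> linarith [h0 u, h1 u]
      _ = 1 := hp
  calc iidMean p r (fun V => |(∑ i, h (V i)) / r - μ|)
      ≤ iidMean p r (fun V => η / 2 + (∑ i, (h (V i) - μ)) ^ 2 * (1 / (2 * η * r ^ 2))) := by
        refine iidMean_mono hp0 fun V => ?_
        have hx : (∑ i, h (V i)) / r - μ = (∑ i, (h (V i) - μ)) / r := by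
          rw [Finset.sum_sub_distrib]
          simp
          field_simp
        rw [hx]
        set x : ℝ := ∑ i, (h (V i) - μ)
        -- the arithmetic-geometric mean inequality `|y| ≤ η / 2 + y ^ 2 / (2 * η)`
        have h2 : x ^ 2 * (1 / (2 * η * r ^ 2)) = |x / r| ^ 2 / (2 * η) := by
          rw [sq_abs]; field_simp
        have h3 : η / 2 = η ^ 2 / (2 * η) := by field_simp
        rw [h2, h3, ← add_div, le_div_iff₀ (by positivity)]
        nlinarith [sq_nonneg (|x / r| - η)]
    _ = η / 2 + r * (∑ u, p u * (h u - μ) ^ 2) * (1 / (2 * η * r ^ 2)) := by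
        rw [iidMean_add, iidMean_const hp, iidMean_mul_const, iidMean_sq_sum_apply hp hcentred]
    _ ≤ η / 2 + r * 1 * (1 / (2 * η * r ^ 2)) := by gcongr
    _ = η / 2 + (1 / η ^ 2) / r * (η / 2) := by field_simp
    _ ≤ η / 2 + 1 * (η / 2) := by
        gcongr
        exact div_le_one_of_le₀ hr hr0.le
    _ = η := by ring

end IidMean

/-! ### Reconstruction of vectors from sampled columns, up to a permutation -/

section Frequency

variable {ι κ : Type*} [Fintype ι] [DecidableEq κ]

/-- The fraction of the indices at which `f` takes the value `t`. -/
noncomputable def freq (f : ι → κ) (t : κ) : ℝ :=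
  ((Finset.univ.filter fun i => f i = t).card : ℝ) / Fintype.card ι

theorem freq_eq_sum (f : ι → κ) (t : κ) :
    freq f t = (∑ i, if f i = t then (1 : ℝ) else 0) / Fintype.card ι := by
  simp [freq]

/-- Two maps can be aligned by a permutation of their domain so that they disagree at no more
points than the `ℓ¹`-distance of their value counts. In a permutation with the most agreements, no
value can have both an unmatched preimage under `f` and an unmatched preimage under `g`: a
transposition would match these two. -/
theorem exists_perm_card_ne_le [Fintype κ] [DecidableEq ι] (f g : ι → κ) :
    ∃ σ : Equiv.Perm ι, ((Finset.univ.filter fun i => f i ≠ g (σ i)).card : ℝ) ≤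
      ∑ t, |((Finset.univ.filter fun i => f i = t).card : ℝ) -
        (Finset.univ.filter fun i => g i = t).card| := by
  obtain ⟨σ, hσ⟩ := Finite.exists_max fun σ : Equiv.Perm ι =>
    (Finset.univ.filter fun i => f i = g (σ i)).card
  refine ⟨σ, ?_⟩
  have hexch : ∀ i j, f i ≠ g (σ i) → f j ≠ g (σ j) → f i ≠ g (σ j) := by
    intro i j hi hj hij
    have hlt : (Finset.univ.filter fun l => f l = g (σ l)) ⊂
        Finset.univ.filter fun l => f l = g ((σ * Equiv.swap i j) l) := by
      rw [Finset.ssubset_iff_of_subset]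
      · exact ⟨i, Finset.mem_filter.2 ⟨Finset.mem_univ _, by simpa using hij⟩, by simpa using hi⟩
      · intro l hl
        simp only [Finset.mem_filter, Finset.mem_univ, true_and] at hl ⊢
        have hli : l ≠ i := fun h => hi (h ▸ hl)
        have hlj : l ≠ j := fun h => hj (h ▸ hl)
        rw [Equiv.Perm.mul_apply, Equiv.swap_apply_of_ne_of_ne hli hlj]
        exact hl
    exact absurd (hσ (σ * Equiv.swap i j)) (not_le.2 (Finset.card_lt_card hlt))
  have hcount : ((Finset.univ.filter fun i => f i ≠ g (σ i)).card : ℝ) =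
      ∑ t, ((Finset.univ.filter fun i => f i = t ∧ g (σ i) ≠ t).card : ℝ) := by
    rw [Finset.card_eq_sum_card_fiberwise (f := f) (t := Finset.univ) (by simp)]
    push_cast
    refine Finset.sum_congr rfl fun t _ => ?_
    congr 2
    ext i
    simp only [Finset.mem_filter, Finset.mem_univ, true_and]
    constructor
    · rintro ⟨h, rfl⟩
      exact ⟨rfl, h.symm⟩
    · rintro ⟨rfl, h⟩
      exact ⟨h.symm, rfl⟩
  rw [hcount]
  refine Finset.sum_le_sum fun t _ => ?_
  set A := Finset.univ.filter fun i => f i = t ∧ g (σ i) ≠ t with hA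
  set B := Finset.univ.filter fun i => g (σ i) = t ∧ f i ≠ t with hB
  have hf : (Finset.univ.filter fun i => f i = t).card =
      (Finset.univ.filter fun i => f i = t ∧ g (σ i) = t).card + A.card := by
    rw [← Finset.card_filter_add_card_filter_not (s := Finset.univ.filter fun i => f i = t)
      fun i => g (σ i) = t, Finset.filter_filter, Finset.filter_filter]
  have hg : (Finset.univ.filter fun i => g i = t).card =
      (Finset.univ.filter fun i => f i = t ∧ g (σ i) = t).card + B.card := by
    have h1 : (Finset.univ.filter fun i => g i = t).card =
        (Finset.univ.filter fun i => g (σ i) = t).card :=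
      (Finset.card_bij (fun i _ => σ i) (by simp) (by simp) fun i hi =>
        ⟨σ.symm i, by simpa using hi, by simp⟩).symm
    rw [h1, ← Finset.card_filter_add_card_filter_not
      (s := Finset.univ.filter fun i => g (σ i) = t) fun i => f i = t, Finset.filter_filter,
      Finset.filter_filter]
    simp only [and_comm, hB]
  rcases A.eq_empty_or_nonempty with h | ⟨i, hi⟩
  · rw [h]
    simp
  · have hBe : B = ∅ := by
      by_contra hne
      obtain ⟨j, hj⟩ := Finset.nonempty_iff_ne_empty.2 hne
      simp only [hA, hB, Finset.mem_filter, Finset.mem_univ, true_and] at hi hj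
      exact hexch i j (fun h => hi.2 (h ▸ hi.1)) (fun h => hj.2 (h.trans hj.1))
        (hi.1.trans hj.1.symm)
    rw [hf, hg, hBe]
    push_cast
    refine le_trans (le_of_eq ?_) (le_abs_self _)
    simp

end Frequency

variable {S k : ℕ}

/-- The column of index `i` in the matrix whose rows are the vectors `X 0, …, X (S - 1)`. -/
def col (X : Fin S → Cube n) (i : Fin n) : Fin S → Bool := fun l => X l i

/-- The `ℓ¹`-distance between the column statistics of `X` and the statistics of the list `Y` of
columns. -/
noncomputable def colDiscrepancy (X : Fin S → Cube n) (Y : Fin k → Fin S → Bool) : ℝ :=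
  ∑ t, |freq Y t - freq (col X) t|

/-- Vectors whose column statistics are as close as possible to those of the list `Y` of columns. -/
noncomputable def reconstruct (n : ℕ) (Y : Fin k → Fin S → Bool) : Fin S → Cube n :=
  Classical.choose (Finite.exists_min fun W : Fin S → Cube n => colDiscrepancy W Y)

theorem colDiscrepancy_reconstruct_le (X : Fin S → Cube n) (Y : Fin k → Fin S → Bool) :
    colDiscrepancy (reconstruct n Y) Y ≤ colDiscrepancy X Y :=
  Classical.choose_spec (Finite.exists_min fun W : Fin S → Cube n => colDiscrepancy W Y) X

/-- The reconstruction is correct up to one common permutation of the indices and an error bounded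
by the discrepancy. -/
theorem exists_perm_dH_reconstruct_le (X : Fin S → Cube n) (Y : Fin k → Fin S → Bool) :
    ∃ σ : Equiv.Perm (Fin n), ∀ l, dH (X l) (fun i => reconstruct n Y l (σ i)) ≤
      2 * colDiscrepancy X Y := by
  set W := reconstruct n Y
  obtain ⟨σ, hσ⟩ := exists_perm_card_ne_le (col X) (col W)
  refine ⟨σ, fun l => ?_⟩
  have hrow : hammingDist (X l) (fun i => W l (σ i)) ≤
      (Finset.univ.filter fun i => col X i ≠ col W (σ i)).card := by
    refine Finset.card_le_card fun i hi => ?_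
    simp only [Finset.mem_filter, Finset.mem_univ, true_and] at hi ⊢
    exact fun h => hi (congrFun h l)
  calc dH (X l) (fun i => W l (σ i))
      ≤ ((Finset.univ.filter fun i => col X i ≠ col W (σ i)).card : ℝ) / n := by
        unfold dH
        gcongr
    _ ≤ (∑ t, |((Finset.univ.filter fun i => col X i = t).card : ℝ) -
          (Finset.univ.filter fun i => col W i = t).card|) / n := by gcongr
    _ = ∑ t, |freq (col X) t - freq (col W) t| := by
        rw [Finset.sum_div]
        refine Finset.sum_congr rfl fun t _ => ?_
        simp only [freq, Fintype.card_fin]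
        rw [← sub_div, abs_div, Nat.abs_cast]
    _ ≤ ∑ t, (|freq Y t - freq (col X) t| + |freq Y t - freq (col W) t|) := by
        refine Finset.sum_le_sum fun t _ => ?_
        rw [abs_sub_comm (freq Y t)]
        exact abs_sub_le _ _ _
    _ = colDiscrepancy X Y + colDiscrepancy W Y := Finset.sum_add_distrib
    _ ≤ 2 * colDiscrepancy X Y := by
        linarith [colDiscrepancy_reconstruct_le X Y]

theorem iidMean_colDiscrepancy_le [NeZero n] (X : Fin S → Cube n) {η : ℝ} (hη : 0 < η)
    (hk : 1 / η ^ 2 ≤ k) :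
    iidMean (fun _ : Fin n => (1 / n : ℝ)) k (fun K => colDiscrepancy X fun l => col X (K l)) ≤
      2 ^ S * η := by
  have hn : (n : ℝ) ≠ 0 := by exact_mod_cast NeZero.ne n
  unfold colDiscrepancy
  rw [iidMean_sum]
  calc _ ≤ ∑ _t : Fin S → Bool, η := by
        refine Finset.sum_le_sum fun t _ => ?_
        refine le_trans (le_of_eq ?_) (iidMean_abs_sub_le
          (p := fun _ : Fin n => (1 / n : ℝ)) (h := fun i => if col X i = t then 1 else 0)
          (fun _ => by positivity) (by simp [hn])
          (fun _ => by split_ifs <;> norm_num) (fun _ => by split_ifs <;> norm_num) hη hk)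
        congr 1
        ext K
        rw [freq_eq_sum, freq_eq_sum, ← Finset.mul_sum, Fintype.card_fin, Fintype.card_fin,
          one_div_mul_eq_div]
    _ = 2 ^ S * η := by simp

/-! ### Quantization of a distribution by independent samples -/

variable {s r : ℕ}

/-- The position of a vector of the list `V` that is nearest to `u`. -/
noncomputable def nearest [NeZero s] (V : Fin s → Cube n) (u : Cube n) : Fin s :=
  Classical.choose (Finite.exists_min fun i => dH u (V i))

theorem dH_nearest_le [NeZero s] (V : Fin s → Cube n) (u : Cube n) (i : Fin s) :
    dH u (V (nearest V u)) ≤ dH u (V i) :=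
  Classical.choose_spec (Finite.exists_min fun i => dH u (V i)) i

/-- The mean distance of a sample of `D` to the list `V`. -/
noncomputable def quantError [NeZero s] (D : PMF (Cube n)) (V : Fin s → Cube n) : ℝ :=
  ∑ u, (D u).toReal * dH u (V (nearest V u))

/-- The mean distance of the vectors of the list `U` to the list `V`. -/
noncomputable def empQuantError [NeZero s] (V : Fin s → Cube n) (U : Fin r → Cube n) : ℝ :=
  (∑ j, dH (U j) (V (nearest V (U j)))) / r

/-- The mass of the vectors whose nearest vector in the list `V` is the one at position `i`. -/
noncomputable def cellMass [NeZero s] (D : PMF (Cube n)) (V : Fin s → Cube n) (i : Fin s) : ℝ :=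
  ∑ u, (D u).toReal * if nearest V u = i then 1 else 0

/-- How far the list `U` is from representing `D` on the Voronoi cells of the list `V`. -/
noncomputable def sampleDeviation [NeZero s] (D : PMF (Cube n)) (V : Fin s → Cube n)
    (U : Fin r → Cube n) : ℝ :=
  |empQuantError V U - quantError D V| + ∑ i, |freq (fun j => nearest V (U j)) i - cellMass D V i|

theorem toReal_nonneg (D : PMF (Cube n)) (u : Cube n) : 0 ≤ (D u).toReal := ENNReal.toReal_nonneg

theorem sampleDeviation_nonneg [NeZero s] (D : PMF (Cube n)) (V : Fin s → Cube n)
    (U : Fin r → Cube n) : 0 ≤ sampleDeviation D V U := by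
  unfold sampleDeviation
  positivity

theorem empQuantError_nonneg [NeZero s] (V : Fin s → Cube n) (U : Fin r → Cube n) :
    0 ≤ empQuantError V U :=
  div_nonneg (Finset.sum_nonneg fun _ _ => dH_nonneg _ _) (Nat.cast_nonneg r)

theorem iidMean_sampleDeviation_le [NeZero s] (D : PMF (Cube n)) (V : Fin s → Cube n) {η : ℝ}
    (hη : 0 < η) (hr : 1 / η ^ 2 ≤ r) :
    iidMean (fun u => (D u).toReal) r (fun U => sampleDeviation D V U) ≤ (s + 1) * η := by
  unfold sampleDeviation
  rw [iidMean_add, iidMean_sum]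
  have h1 := iidMean_abs_sub_le (toReal_nonneg D) (sum_toReal D)
    (h := fun u => dH u (V (nearest V u))) (fun _ => dH_nonneg _ _) (fun _ => dH_le_one _ _) hη hr
  have h2 : ∀ i, iidMean (fun u => (D u).toReal) r
      (fun U => |freq (fun j => nearest V (U j)) i - cellMass D V i|) ≤ η := fun i => by
    refine le_trans (le_of_eq ?_) (iidMean_abs_sub_le (toReal_nonneg D) (sum_toReal D)
      (h := fun u => if nearest V u = i then 1 else 0)
      (fun _ => by split_ifs <;> norm_num) (fun _ => by split_ifs <;> norm_num) hη hr)
    congr 1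
    ext U
    rw [freq_eq_sum, Fintype.card_fin]
    rfl
  calc _ ≤ η + ∑ _i : Fin s, η := add_le_add h1 (Finset.sum_le_sum fun i _ => h2 i)
    _ = (s + 1) * η := by simp; ring

theorem map_comp_apply_toReal {Ω : Type*} [Fintype Ω] (ρ : PMF Ω) (a : Ω → Fin s)
    (V : Fin s → Cube n) (X : Cube n) :
    (ρ.map (fun u => V (a u)) X).toReal =
      ∑ i, if X = V i then ∑ u, (ρ u).toReal * (if a u = i then 1 else 0) else 0 := by
  have h : ∀ i, (if X = V i then ∑ u, (ρ u).toReal * (if a u = i then 1 else 0) else 0) =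
      ∑ u, if a u = i then (if X = V i then (ρ u).toReal else 0) else 0 := fun i => by
    split_ifs <;> simp
  rw [map_apply_toReal, Finset.sum_congr rfl fun i _ => h i, Finset.sum_comm]
  simp

/-- Move `D` onto the list `V`, correct the masses of the cells, and move the cells onto the
vectors of the list `W`, which is close to a list `U` that represents `D` well. -/
theorem transport_map_uniform [NeZero s] [NeZero r] (D : PMF (Cube n)) (V : Fin s → Cube n)
    (U W : Fin r → Cube n) {δ : ℝ} (hW : ∀ j, dH (U j) (W j) ≤ δ) :
    Transport D ((PMF.uniformOfFintype (Fin r)).map W)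
      (2 * empQuantError V U + sampleDeviation D V U + δ) := by
  have hr : (r : ℝ) ≠ 0 := by exact_mod_cast NeZero.ne r
  set a : Cube n → Fin s := nearest V with ha
  set ρ : PMF (Fin r) := PMF.uniformOfFintype (Fin r) with hρ
  have hρj : ∀ j, (ρ j).toReal = 1 / r := fun j => by simp [hρ]
  have h1 : Transport D (D.map fun u => V (a u)) (quantError D V) := by
    have := transport_map_map D id fun u => V (a u)
    rwa [PMF.map_id] at this
  have h3 : Transport (ρ.map fun j => V (a (U j))) (ρ.map W) (empQuantError V U + δ) := by
    obtain ⟨f, hf, hc⟩ := transport_map_map ρ (fun j => V (a (U j))) W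
    refine ⟨f, hf, hc.trans ?_⟩
    calc ∑ j, (ρ j).toReal * dH (V (a (U j))) (W j)
        ≤ ∑ j, 1 / r * (dH (U j) (V (a (U j))) + δ) := by
          refine Finset.sum_le_sum fun j _ => ?_
          rw [hρj]
          have := dH_triangle (V (a (U j))) (U j) (W j)
          rw [dH_comm (V (a (U j))) (U j)] at this
          gcongr
          linarith [hW j]
      _ = empQuantError V U + δ := by
          unfold empQuantError
          rw [← ha, ← Finset.mul_sum, Finset.sum_add_distrib]
          simp
          field_simp
  have h2 : Transport (D.map fun u => V (a u)) (ρ.map fun j => V (a (U j)))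
      (∑ i, |freq (fun j => a (U j)) i - cellMass D V i|) := by
    obtain ⟨f, hf, hc⟩ := transport_of_sum_abs_sub (D.map fun u => V (a u))
      (ρ.map fun j => V (a (U j)))
    refine ⟨f, hf, hc.trans ?_⟩
    have hX : ∀ X, |(D.map (fun u => V (a u)) X).toReal -
        (ρ.map (fun j => V (a (U j))) X).toReal| ≤
        ∑ i, if X = V i then |freq (fun j => a (U j)) i - cellMass D V i| else 0 := fun X => by
      have e1 : (D.map (fun u => V (a u)) X).toReal =
          ∑ i, if X = V i then cellMass D V i else 0 := by
        exact map_comp_apply_toReal D a V X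
      have e2 : (ρ.map (fun j => V (a (U j))) X).toReal =
          ∑ i, if X = V i then freq (fun j => a (U j)) i else 0 := by
        rw [map_comp_apply_toReal ρ (fun j => a (U j)) V X]
        simp only [freq_eq_sum, hρj, one_div_mul_eq_div, Fintype.card_fin, Finset.sum_div]
      rw [e1, e2, abs_sub_comm, ← Finset.sum_sub_distrib]
      refine (Finset.abs_sum_le_sum_abs _ _).trans (le_of_eq (Finset.sum_congr rfl fun i _ => ?_))
      split_ifs <;> simp
    refine (Finset.sum_le_sum fun X _ => hX X).trans (le_of_eq ?_)
    rw [Finset.sum_comm]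
    simp
  obtain ⟨f, hf, hc⟩ := (h1.trans h2).trans h3
  refine ⟨f, hf, hc.trans ?_⟩
  unfold sampleDeviation
  have := neg_le_abs (empQuantError V U - quantError D V)
  linarith

theorem mul_one_sub_half_pow_le {x : ℝ} (h0 : 0 ≤ x) (h1 : x ≤ 1) (hs : 0 < s) :
    x * (1 - x / 2) ^ s ≤ 2 / s := by
  have hs' : (0 : ℝ) < s := by exact_mod_cast hs
  have h2 : (0 : ℝ) ≤ 1 - x / 2 := by linarith
  have hb : 1 + s * (x / 2) ≤ (1 + x / 2) ^ s := one_add_mul_le_pow (by linarith) s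
  have hp : (1 + x / 2) ^ s * (1 - x / 2) ^ s ≤ 1 := by
    rw [← mul_pow]
    exact pow_le_one₀ (by nlinarith) (by nlinarith)
  have h3 : (0 : ℝ) ≤ (1 - x / 2) ^ s := pow_nonneg h2 s
  rw [le_div_iff₀ hs']
  nlinarith [mul_le_mul_of_nonneg_right hb h3]

/-- A point `z` that receives the mass `m` at cost `c` is likely to have some sample at distance at
most `2 * c / m`, since at least half of that mass comes from within this distance. -/
theorem mul_iidMean_dH_nearest_le [NeZero s] (D : PMF (Cube n)) (z : Cube n)
    {f : Cube n → ℝ} (hf0 : ∀ u, 0 ≤ f u) (hfD : ∀ u, f u ≤ (D u).toReal) :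
    (∑ u, f u) * iidMean (fun u => (D u).toReal) s (fun V => dH z (V (nearest V z))) ≤
      2 * (∑ u, f u * dH u z) + 2 / s := by
  set m : ℝ := ∑ u, f u with hm
  set c : ℝ := ∑ u, f u * dH u z with hc
  have hm0 : 0 ≤ m := Finset.sum_nonneg fun u _ => hf0 u
  have hm1 : m ≤ 1 := (Finset.sum_le_sum fun u _ => hfD u).trans_eq (sum_toReal D)
  have hc0 : 0 ≤ c := Finset.sum_nonneg fun u _ => mul_nonneg (hf0 u) (dH_nonneg u z)
  rcases hm0.eq_or_lt with hm' | hm'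
  · rw [← hm', zero_mul]
    positivity
  set t : ℝ := 2 * c / m with ht
  have ht0 : 0 ≤ t := by positivity
  have hfar : ∑ u, f u * (if t < dH z u then 1 else 0) ≤ m / 2 := by
    have hle : (∑ u, f u * (if t < dH z u then 1 else 0)) * t ≤ c := by
      rw [Finset.sum_mul]
      refine Finset.sum_le_sum fun u _ => ?_
      rw [mul_assoc, dH_comm u z]
      refine mul_le_mul_of_nonneg_left ?_ (hf0 u)
      split_ifs with h
      · linarith
      · simpa using dH_nonneg z u
    rcases hc0.eq_or_lt with hc' | hc'
    · have ht' : t = 0 := by rw [ht, ← hc']; simp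
      rw [Finset.sum_eq_zero]
      · positivity
      · intro u _
        have h0 := (Finset.sum_eq_zero_iff_of_nonneg fun u _ =>
          mul_nonneg (hf0 u) (dH_nonneg u z)).1 hc'.symm u (Finset.mem_univ u)
        rcases mul_eq_zero.1 h0 with h | h
        · simp [h]
        · rw [dH_comm, h, ht']
          simp
    · have htm : t * m = 2 * c := div_mul_cancel₀ _ hm'.ne'
      have htpos : 0 < t := by positivity
      by_contra! hcon
      nlinarith
  have hprob : ∑ u, (D u).toReal * (if t < dH z u then 1 else 0) ≤ 1 - m / 2 := by
    have : ∑ u, ((D u).toReal - f u) * (if t < dH z u then (1 : ℝ) else 0) ≤ 1 - m := by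
      calc _ ≤ ∑ u, ((D u).toReal - f u) := by
            refine Finset.sum_le_sum fun u _ => ?_
            refine mul_le_of_le_one_right (sub_nonneg.2 (hfD u)) ?_
            split_ifs <;> norm_num
        _ = 1 - m := by rw [Finset.sum_sub_distrib, sum_toReal]
    simp only [sub_mul, Finset.sum_sub_distrib] at this
    linarith
  have hmean : iidMean (fun u => (D u).toReal) s (fun V => dH z (V (nearest V z))) ≤
      t + (1 - m / 2) ^ s := by
    calc _ ≤ iidMean (fun u => (D u).toReal) s
          (fun V => t + ∏ i, if t < dH z (V i) then 1 else 0) := by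
          refine iidMean_mono (toReal_nonneg D) fun V => ?_
          by_cases h : ∃ i, dH z (V i) ≤ t
          · obtain ⟨i, hi⟩ := h
            have : (0 : ℝ) ≤ ∏ i, if t < dH z (V i) then 1 else 0 :=
              Finset.prod_nonneg fun i _ => by split_ifs <;> norm_num
            linarith [dH_nearest_le V z i]
          · push Not at h
            simp only [h, if_true, Finset.prod_const_one]
            linarith [dH_le_one z (V (nearest V z))]
      _ ≤ t + (1 - m / 2) ^ s := by
          rw [iidMean_add, iidMean_const (sum_toReal D),
            iidMean_prod (p := fun u => (D u).toReal) fun u => if t < dH z u then 1 else 0]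
          gcongr
  calc _ ≤ m * (t + (1 - m / 2) ^ s) := mul_le_mul_of_nonneg_left hmean hm0
    _ = 2 * c + m * (1 - m / 2) ^ s := by
        rw [mul_add, ht, mul_div_cancel₀ _ hm'.ne']
    _ ≤ 2 * c + 2 / s := by
        gcongr
        exact mul_one_sub_half_pow_le hm0 hm1 (Nat.pos_of_ne_zero (NeZero.ne s))

/-- If `D` is close to a distribution with few atoms, then a list of samples quantizes `D`
well. -/
theorem iidMean_quantError_le [NeZero s] {D D₁ : PMF (Cube n)} {γ : ℝ} (h : Transport D D₁ γ)
    {M : Finset (Cube n)} (hM : ∀ z, z ∉ M → D₁ z = 0) :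
    iidMean (fun u => (D u).toReal) s (fun V => quantError D V) ≤ 3 * γ + M.card * (2 / s) := by
  obtain ⟨f, hf, hc⟩ := h
  have hfD : ∀ u z, f u z ≤ (D u).toReal := fun u z => by
    rw [← hf.sum_right u]
    exact Finset.single_le_sum (fun z _ => hf.nonneg u z) (Finset.mem_univ z)
  have hcost : ∑ z, ∑ u, f u z * dH u z ≤ γ := by rwa [Finset.sum_comm]
  have hz : ∀ z, (∑ u, f u z) *
      iidMean (fun u => (D u).toReal) s (fun V => dH z (V (nearest V z))) ≤
      2 * (∑ u, f u z * dH u z) + if z ∈ M then 2 / (s : ℝ) else 0 := fun z => by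
    split_ifs with hzM
    · exact mul_iidMean_dH_nearest_le D z (fun u => hf.nonneg u z) fun u => hfD u z
    · rw [hf.sum_left, hM z hzM, ENNReal.toReal_zero, zero_mul, add_zero]
      exact mul_nonneg zero_le_two
        (Finset.sum_nonneg fun u _ => mul_nonneg (hf.nonneg u z) (dH_nonneg u z))
  calc iidMean (fun u => (D u).toReal) s (fun V => quantError D V)
      ≤ iidMean (fun u => (D u).toReal) s
          (fun V => γ + ∑ z, dH z (V (nearest V z)) * ∑ u, f u z) := by
        refine iidMean_mono (toReal_nonneg D) fun V => ?_
        calc quantError D V = ∑ z, ∑ u, f u z * dH u (V (nearest V u)) := by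
              rw [Finset.sum_comm]
              refine Finset.sum_congr rfl fun u _ => ?_
              rw [← Finset.sum_mul, hf.sum_right]
          _ ≤ ∑ z, ∑ u, (f u z * dH u z + dH z (V (nearest V z)) * f u z) := by
              refine Finset.sum_le_sum fun z _ => Finset.sum_le_sum fun u _ => ?_
              rw [mul_comm (dH z _), ← mul_add]
              exact mul_le_mul_of_nonneg_left ((dH_nearest_le V u _).trans (dH_triangle u z _))
                (hf.nonneg u z)
          _ ≤ γ + ∑ z, dH z (V (nearest V z)) * ∑ u, f u z := by
              simp only [Finset.sum_add_distrib, ← Finset.mul_sum]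
              linarith
    _ = γ + ∑ z, (∑ u, f u z) *
          iidMean (fun u => (D u).toReal) s (fun V => dH z (V (nearest V z))) := by
        rw [iidMean_add, iidMean_const (sum_toReal D), iidMean_sum]
        simp only [iidMean_mul_const, mul_comm]
    _ ≤ γ + ∑ z, (2 * (∑ u, f u z * dH u z) + if z ∈ M then 2 / (s : ℝ) else 0) := by
        gcongr with z
        exact hz z
    _ = γ + 2 * (∑ z, ∑ u, f u z * dH u z) + M.card * (2 / s) := by
        rw [Finset.sum_add_distrib, ← Finset.mul_sum]
        simp
        ring
    _ ≤ 3 * γ + M.card * (2 / s) := by linarith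

/-- Rounding a distribution to a net of its support leaves only boundedly many atoms. -/
theorem exists_transport_of_isCloseToVCDim (d : ℕ) {δ : ℝ} (hδ0 : 0 < δ) (hδ1 : δ < 1) :
    ∃ m : ℕ, ∀ n : ℕ, 0 < n → ∀ (D : PMF (Cube n)) (β : ℝ), IsCloseToVCDim D β d →
      ∃ (D₁ : PMF (Cube n)) (M : Finset (Cube n)), M.card ≤ m ∧ (∀ z, z ∉ M → D₁ z = 0) ∧
        Transport D D₁ (β + δ + δ) := by
  classical
  obtain ⟨m, hm⟩ := exists_net d hδ0 hδ1
  refine ⟨m, fun n hn D β hD => ?_⟩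
  obtain ⟨D₀, hD₀, hemd⟩ := hD
  obtain ⟨M, hMm, hM⟩ := hm n hn D₀ hD₀
  have hM' : ∀ v, ∃ z, v ∈ D₀.support → z ∈ M ∧ dH v z ≤ δ := fun v => by
    by_cases hv : v ∈ D₀.support
    · obtain ⟨z, hz⟩ := hM v hv
      exact ⟨z, fun _ => hz⟩
    · exact ⟨v, fun h => absurd h hv⟩
  choose b hb using hM'
  refine ⟨D₀.map b, M, hMm, fun z hz => ?_, ?_⟩
  · rw [PMF.apply_eq_zero_iff, PMF.mem_support_map_iff]
    rintro ⟨v, hv, rfl⟩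
    exact hz (hb v hv).1
  · have h1 : Transport D D₀ (β + δ) := transport_of_emd_lt (by linarith)
    have h2 : Transport D₀ (D₀.map b) δ := by
      obtain ⟨f, hf, hc⟩ := transport_map_map D₀ id b
      rw [PMF.map_id] at hf
      refine ⟨f, hf, hc.trans ?_⟩
      calc ∑ u, (D₀ u).toReal * dH (id u) (b u) ≤ ∑ u, (D₀ u).toReal * δ := by
            refine Finset.sum_le_sum fun u _ => ?_
            rcases eq_or_ne (D₀ u) 0 with h | h
            · simp [h]
            · exact mul_le_mul_of_nonneg_left (hb u ((D₀.mem_support_iff u).2 h)).2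
                ENNReal.toReal_nonneg
        _ = δ := by rw [← Finset.sum_mul, sum_toReal, one_mul]
    exact h1.trans h2

/-! ### The learner -/

open Classical in
/-- The output computed from the list `Y` of queried columns of a matrix with `s + r` rows: rows
with similar column statistics are produced, and the uniform distribution on the last `r` of them is
accepted if these rows are on average within `c` of the first `s` rows. -/
noncomputable def clusterOutput (n s r : ℕ) [NeZero r] (c : ℝ) (Y : Fin k → Fin (s + r) → Bool) :
    Option (PMF (Cube n)) :=
  if ∃ b : Fin r → Fin s, ∑ j, dH (reconstruct n Y (Fin.natAdd s j))
      (reconstruct n Y (Fin.castAdd r (b j))) ≤ c * r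
  then some ((PMF.uniformOfFintype (Fin r)).map fun j => reconstruct n Y (Fin.natAdd s j))
  else none

/-- The learner that queries `k` random indices, the same ones in each of `s + r` samples. -/
noncomputable def clusterLearner (n s r k : ℕ) [NeZero n] [NeZero r] (c : ℝ) :
    NonAdaptiveLearner n (s + r) ((s + r) * k) where
  Coins := Fin k → Fin n
  finite_coins := inferInstance
  coins := PMF.uniformOfFintype _
  querySet K _ := Finset.univ.image K
  card_le K := by
    calc ∑ _i : Fin (s + r), (Finset.univ.image K).card ≤ ∑ _i : Fin (s + r), k :=
          Finset.sum_le_sum fun _ _ => Finset.card_image_le.trans (by simp)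
      _ = (s + r) * k := by simp
  output K ans := clusterOutput n s r c fun l i =>
    ans i ⟨K l, Finset.mem_image_of_mem K (Finset.mem_univ l)⟩

/-- The learner that always fails, used where the parameters are out of range. -/
noncomputable def failLearner (n s q : ℕ) : NonAdaptiveLearner n s q where
  Coins := Unit
  finite_coins := inferInstance
  coins := PMF.pure ()
  querySet _ _ := ∅
  card_le _ := by simp
  output _ _ := none

/-- Markov's inequality for the learner: the probability of an event is at most the mean of any
nonnegative quantity that is at least `1` on this event. -/
theorem prob_run_clusterLearner_le [NeZero n] [NeZero r] (c : ℝ) (D : PMF (Cube n))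
    (E : Set (Option (PMF (Cube n)))) (Φ : (Fin (s + r) → Cube n) → (Fin k → Fin n) → ℝ)
    (h0 : ∀ X K, 0 ≤ Φ X K)
    (h1 : ∀ X K, clusterOutput n s r c (fun l => col X (K l)) ∈ E → 1 ≤ Φ X K) :
    prob ((clusterLearner n s r k c).run D) E ≤ ENNReal.ofReal
      (iidMean (fun u => (D u).toReal) (s + r) fun X =>
        iidMean (fun _ : Fin n => (1 / n : ℝ)) k fun K => Φ X K) := by
  classical
  have hcoin : ∀ K : Fin k → Fin n, PMF.uniformOfFintype (Fin k → Fin n) K =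
      ENNReal.ofReal (∏ _l : Fin k, (1 / n : ℝ)) := fun K => by
    have hn : (0 : ℝ) < (n : ℝ) ^ k := by
      have : 0 < n := Nat.pos_of_ne_zero (NeZero.ne n)
      positivity
    simp only [PMF.uniformOfFintype_apply, Fintype.card_fun, Fintype.card_fin, Finset.prod_const,
      Finset.card_univ, one_div, inv_pow]
    rw [ENNReal.ofReal_inv_of_pos hn, ← Nat.cast_pow, ENNReal.ofReal_natCast]
  have hsample : ∀ X : Fin (s + r) → Cube n, iidSamples (s + r) D X =
      ENNReal.ofReal (∏ i, (D (X i)).toReal) := fun X => by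
    rw [ENNReal.ofReal_prod_of_nonneg fun i _ => ENNReal.toReal_nonneg]
    simp only [ENNReal.ofReal_toReal (D.apply_ne_top _)]
    rfl
  have hprob : prob ((clusterLearner n s r k c).run D) E =
      ∑ K, PMF.uniformOfFintype (Fin k → Fin n) K *
        ∑ X, Set.indicator ((fun X : Fin (s + r) → Cube n =>
          clusterOutput n s r c fun l => col X (K l)) ⁻¹' E) (iidSamples (s + r) D) X := by
    unfold prob NonAdaptiveLearner.run
    rw [PMF.toOuterMeasure_bind_apply]
    refine (tsum_fintype (β := Fin k → Fin n) (L := .unconditional _) _).trans ?_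
    refine Finset.sum_congr rfl fun K _ => ?_
    rw [PMF.toOuterMeasure_map_apply, PMF.toOuterMeasure_apply_fintype]
    rfl
  have hpX : ∀ X : Fin (s + r) → Cube n, 0 ≤ ∏ i, (D (X i)).toReal := fun X =>
    Finset.prod_nonneg fun i _ => ENNReal.toReal_nonneg
  have hpK : 0 ≤ ∏ _l : Fin k, (1 / n : ℝ) := by positivity
  have hmean : (iidMean (fun u => (D u).toReal) (s + r) fun X =>
      iidMean (fun _ : Fin n => (1 / n : ℝ)) k fun K => Φ X K) =
      ∑ K : Fin k → Fin n, (∏ _l : Fin k, (1 / n : ℝ)) *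
        ∑ X : Fin (s + r) → Cube n, (∏ i, (D (X i)).toReal) * Φ X K := by
    simp only [iidMean, Finset.mul_sum]
    rw [Finset.sum_comm]
    refine Finset.sum_congr rfl fun K _ => Finset.sum_congr rfl fun X _ => ?_
    ring
  have hsum0 : ∀ K : Fin k → Fin n,
      0 ≤ ∑ X : Fin (s + r) → Cube n, (∏ i, (D (X i)).toReal) * Φ X K := fun K =>
    Finset.sum_nonneg fun X _ => mul_nonneg (hpX X) (h0 X K)
  rw [hprob, hmean, ENNReal.ofReal_sum_of_nonneg fun K _ => mul_nonneg hpK (hsum0 K)]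
  refine Finset.sum_le_sum fun K _ => ?_
  rw [ENNReal.ofReal_mul hpK, hcoin, ENNReal.ofReal_sum_of_nonneg fun X _ =>
    mul_nonneg (hpX X) (h0 X K)]
  gcongr with X
  rw [ENNReal.ofReal_mul (hpX X), Set.indicator_apply]
  split_ifs with h
  · rw [hsample]
    refine le_mul_of_one_le_right' ?_
    rw [← ENNReal.ofReal_one]
    exact ENNReal.ofReal_le_ofReal (h1 X K h)
  · exact zero_le

/-- The first `s` vectors of a list. -/
def centers (X : Fin (s + r) → Cube n) : Fin s → Cube n := fun i => X (Fin.castAdd r i)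

/-- The last `r` vectors of a list. -/
def tests (X : Fin (s + r) → Cube n) : Fin r → Cube n := fun j => X (Fin.natAdd s j)

theorem centers_append (V : Fin s → Cube n) (U : Fin r → Cube n) :
    centers (Fin.append V U) = V := by
  ext i
  simp [centers]

theorem tests_append (V : Fin s → Cube n) (U : Fin r → Cube n) :
    tests (Fin.append V U) = U := by
  ext i
  simp [tests]

section Deterministic

variable [NeZero s] [NeZero r] {c δ : ℝ} {X : Fin (s + r) → Cube n} {Y : Fin k → Fin (s + r) → Bool}

/-- If the queries represent the columns of the sample matrix, and the sample represents `D`, then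
whatever is accepted is correct. -/
theorem emd_le_of_clusterOutput_eq_some {D D' : PMF (Cube n)} (hY : colDiscrepancy X Y ≤ δ)
    (hX : sampleDeviation D (centers X) (tests X) ≤ δ) (hout : clusterOutput n s r c Y = some D') :
    ∃ σ : Equiv.Perm (Fin n), emd D (permute σ D') ≤ 2 * c + 11 * δ := by
  have hr : (0 : ℝ) < r := by exact_mod_cast Nat.pos_of_ne_zero (NeZero.ne r)
  obtain ⟨σ, hσ⟩ := exists_perm_dH_reconstruct_le X Y
  set W := reconstruct n Y
  unfold clusterOutput at hout
  split_ifs at hout with hb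
  obtain ⟨b, hb⟩ := hb
  rw [← Option.some.inj hout]
  have hσ' : ∀ l, dH (X l) (fun i => W l (σ i)) ≤ 2 * δ := fun l => (hσ l).trans (by linarith)
  have hemp : empQuantError (centers X) (tests X) ≤ c + 4 * δ := by
    unfold empQuantError
    rw [div_le_iff₀ hr]
    calc ∑ j, dH (tests X j) (centers X (nearest (centers X) (tests X j)))
        ≤ ∑ j, (dH (W (Fin.natAdd s j)) (W (Fin.castAdd r (b j))) + 4 * δ) := by
          refine Finset.sum_le_sum fun j _ => (dH_nearest_le _ _ (b j)).trans ?_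
          set u := X (Fin.natAdd s j)
          set v := X (Fin.castAdd r (b j))
          have h1 := dH_triangle u (fun i => W (Fin.natAdd s j) (σ i)) v
          have h2 := dH_triangle (fun i => W (Fin.natAdd s j) (σ i))
            (fun i => W (Fin.castAdd r (b j)) (σ i)) v
          rw [dH_comp_perm, dH_comm (fun i => W (Fin.castAdd r (b j)) (σ i)) v] at h2
          have h3 := hσ' (Fin.natAdd s j)
          have h4 := hσ' (Fin.castAdd r (b j))
          change dH u v ≤ _
          linarith
      _ ≤ c * r + r * (4 * δ) := by
          rw [Finset.sum_add_distrib]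
          simpa using hb
      _ = (c + 4 * δ) * r := by ring
  have htr := transport_map_uniform D (centers X) (tests X)
    (fun j i => W (Fin.natAdd s j) (σ i)) (δ := 2 * δ) fun j => hσ' (Fin.natAdd s j)
  refine ⟨σ, ?_⟩
  unfold permute
  rw [PMF.map_comp]
  exact htr.emd_le.trans (by linarith)

/-- If the queries represent the columns of the sample matrix, then a well clustered sample is
accepted. -/
theorem clusterOutput_ne_none (hY : colDiscrepancy X Y ≤ δ)
    (hX : empQuantError (centers X) (tests X) ≤ c - 4 * δ) :
    clusterOutput n s r c Y ≠ none := by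
  have hr : (0 : ℝ) < r := by exact_mod_cast Nat.pos_of_ne_zero (NeZero.ne r)
  obtain ⟨σ, hσ⟩ := exists_perm_dH_reconstruct_le X Y
  set W := reconstruct n Y
  have hσ' : ∀ l, dH (X l) (fun i => W l (σ i)) ≤ 2 * δ := fun l => (hσ l).trans (by linarith)
  unfold clusterOutput
  rw [if_pos]
  · exact Option.some_ne_none _
  refine ⟨fun j => nearest (centers X) (tests X j), ?_⟩
  unfold empQuantError at hX
  rw [div_le_iff₀ hr] at hX
  calc ∑ j, dH (W (Fin.natAdd s j)) (W (Fin.castAdd r (nearest (centers X) (tests X j))))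
      ≤ ∑ j, (dH (tests X j) (centers X (nearest (centers X) (tests X j))) + 4 * δ) := by
        refine Finset.sum_le_sum fun j _ => ?_
        rw [← dH_comp_perm σ]
        have h3 := hσ' (Fin.natAdd s j)
        have h4 := hσ' (Fin.castAdd r (nearest (centers X) (tests X j)))
        set l := Fin.castAdd r (nearest (centers X) (tests X j)) with hl
        have h1 := dH_triangle (fun i => W (Fin.natAdd s j) (σ i)) (X (Fin.natAdd s j))
          fun i => W l (σ i)
        have h2 := dH_triangle (X (Fin.natAdd s j)) (X l) fun i => W l (σ i)
        rw [dH_comm _ (X (Fin.natAdd s j))] at h1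
        have h5 : dH (tests X j) (centers X (nearest (centers X) (tests X j))) =
            dH (X (Fin.natAdd s j)) (X l) := rfl
        rw [h5]
        linarith
    _ = ∑ j, dH (tests X j) (centers X (nearest (centers X) (tests X j))) + r * (4 * δ) := by
        rw [Finset.sum_add_distrib]
        simp
    _ ≤ c * r := by linarith

end Deterministic

section Means

variable [NeZero s] {D : PMF (Cube n)}

theorem iidMean_sampleDeviation_append_le {η : ℝ} (hη : 0 < η) (hr : 1 / η ^ 2 ≤ r) :
    iidMean (fun u => (D u).toReal) (s + r)
      (fun X => sampleDeviation D (centers X) (tests X)) ≤ (s + 1) * η := by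
  rw [iidMean_append]
  simp only [centers_append, tests_append]
  refine (iidMean_mono (toReal_nonneg D) fun V => iidMean_sampleDeviation_le D V hη hr).trans_eq ?_
  exact iidMean_const (sum_toReal D) _

theorem iidMean_empQuantError_append [NeZero r] :
    iidMean (fun u => (D u).toReal) (s + r)
      (fun X => empQuantError (centers X) (tests X)) =
      iidMean (fun u => (D u).toReal) s (fun V => quantError D V) := by
  have hr : (r : ℝ) ≠ 0 := by exact_mod_cast NeZero.ne r
  rw [iidMean_append]
  simp only [centers_append, tests_append]
  congr 1
  ext V
  unfold empQuantError
  rw [iidMean_div_const, iidMean_sum_apply (sum_toReal D) fun u => dH u (V (nearest V u)),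
    mul_div_cancel_left₀ _ hr]
  rfl

end Means

/-- For sufficiently many samples and queries, the learner is correct up to a multiple of
`β + δ`. The mean quantization error is at most `3 * (β + 2 * δ) + δ` in the close case; the
threshold `c = 18 * β + 46 * δ` is chosen so that `c - 4 * δ`, where `4 * δ` allows for the
reconstruction errors, is six times this value. Accepted outputs then have an error of at most
`2 * c + 11 * δ = 36 * β + 103 * δ`. -/
theorem exists_clusterLearner (d : ℕ) {β δ : ℝ} (hβ : 0 < β) (hδ0 : 0 < δ) (hδ1 : δ < 1) :
    ∃ (s r k : ℕ) (_ : NeZero s) (_ : NeZero r), ∀ n : ℕ, ∀ _ : NeZero n, ∀ D : PMF (Cube n),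
      (IsCloseToVCDim D β d →
        2 / 3 ≤ prob ((clusterLearner n s r k (18 * β + 46 * δ)).run D)
          {o | ∃ D', o = some D' ∧
            ∃ σ : Equiv.Perm (Fin n), emd D (permute σ D') ≤ 36 * β + 103 * δ}) ∧
      prob ((clusterLearner n s r k (18 * β + 46 * δ)).run D)
          {o | ∃ D', o = some D' ∧
            ∀ σ : Equiv.Perm (Fin n), 36 * β + 103 * δ < emd D (permute σ D')} ≤ 1 / 3 := by
  obtain ⟨m, hm⟩ := exists_transport_of_isCloseToVCDim d hδ0 hδ1
  obtain ⟨s, hs⟩ := exists_nat_gt (2 * m / δ)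
  have hs0 : (0 : ℝ) < s := lt_of_le_of_lt (by positivity) hs
  have : NeZero s := ⟨by rintro rfl; simp at hs0⟩
  set η : ℝ := δ / (12 * (s + 1)) with hη
  have hη0 : 0 < η := by positivity
  obtain ⟨r, hr⟩ := exists_nat_gt (1 / η ^ 2)
  have hr0 : (0 : ℝ) < r := lt_of_le_of_lt (by positivity) hr
  have : NeZero r := ⟨by rintro rfl; simp at hr0⟩
  set θ : ℝ := δ / (12 * 2 ^ (s + r)) with hθ
  have hθ0 : 0 < θ := by positivity
  obtain ⟨k, hk⟩ := exists_nat_gt (1 / θ ^ 2)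
  refine ⟨s, r, k, ‹_›, ‹_›, fun n _ D => ?_⟩
  have hn : (n : ℝ) ≠ 0 := by exact_mod_cast NeZero.ne n
  set c : ℝ := 18 * β + 46 * δ with hc
  set err : (Fin (s + r) → Cube n) → (Fin k → Fin n) → ℝ := fun X K =>
    (colDiscrepancy X fun l => col X (K l)) / δ +
      sampleDeviation D (centers X) (tests X) / δ with herr
  have hunif : ∑ _i : Fin n, (1 / n : ℝ) = 1 := by simp [hn]
  have hcol0 : ∀ (X : Fin (s + r) → Cube n) (K : Fin k → Fin n),
      0 ≤ colDiscrepancy X fun l => col X (K l) := fun X K =>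
    Finset.sum_nonneg fun _ _ => abs_nonneg _
  have herr0 : ∀ X K, 0 ≤ err X K := fun X K =>
    add_nonneg (div_nonneg (hcol0 X K) hδ0.le) (div_nonneg (sampleDeviation_nonneg _ _ _) hδ0.le)
  have herr1 : ∀ X K, err X K < 1 → (colDiscrepancy X fun l => col X (K l)) ≤ δ ∧
      sampleDeviation D (centers X) (tests X) ≤ δ := fun X K h => by
    have h1 := div_nonneg (hcol0 X K) hδ0.le
    have h2 := div_nonneg (sampleDeviation_nonneg D (centers X) (tests X)) hδ0.le
    constructor
    · exact ((div_lt_one hδ0).1 (by simp only [herr] at h; linarith)).le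
    · exact ((div_lt_one hδ0).1 (by simp only [herr] at h; linarith)).le
  have hmean : (iidMean (fun u => (D u).toReal) (s + r) fun X =>
      iidMean (fun _ : Fin n => (1 / n : ℝ)) k fun K => err X K) ≤ 1 / 6 := by
    calc _ ≤ iidMean (fun u => (D u).toReal) (s + r) (fun X => 1 / 12 +
          sampleDeviation D (centers X) (tests X) / δ) := by
          refine iidMean_mono (toReal_nonneg D) fun X => ?_
          rw [herr, iidMean_add, iidMean_const hunif, iidMean_div_const]
          refine add_le_add ?_ le_rfl
          calc _ ≤ 2 ^ (s + r) * θ / δ := by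
                gcongr
                exact iidMean_colDiscrepancy_le X hθ0 hk.le
            _ = 1 / 12 := by rw [hθ]; field_simp
      _ ≤ 1 / 12 + 1 / 12 := by
          rw [iidMean_add, iidMean_const (sum_toReal D), iidMean_div_const]
          refine add_le_add le_rfl ?_
          calc _ ≤ (s + 1) * η / δ := by
                gcongr
                exact iidMean_sampleDeviation_append_le hη0 hr.le
            _ = 1 / 12 := by rw [hη]; field_simp
      _ = 1 / 6 := by norm_num
  have hsound : ∀ X K D', err X K < 1 →
      clusterOutput n s r c (fun l => col X (K l)) = some D' →
      ∃ σ : Equiv.Perm (Fin n), emd D (permute σ D') ≤ 36 * β + 103 * δ := fun X K D' h hout => by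
    obtain ⟨σ, hσ⟩ := emd_le_of_clusterOutput_eq_some (herr1 X K h).1 (herr1 X K h).2 hout
    exact ⟨σ, hσ.trans_eq (by rw [hc]; ring)⟩
  constructor
  · intro hD
    obtain ⟨D₁, M, hMm, hM, htr⟩ := hm n (Nat.pos_of_ne_zero (NeZero.ne n)) D β hD
    have hc0 : 0 < c - 4 * δ := by rw [hc]; linarith
    set good : Set (Option (PMF (Cube n))) := {o | ∃ D', o = some D' ∧
      ∃ σ : Equiv.Perm (Fin n), emd D (permute σ D') ≤ 36 * β + 103 * δ} with hgood
    set run := (clusterLearner n s r k c).run D with hrun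
    have hbad : prob run goodᶜ ≤ 1 / 3 := by
      refine (prob_run_clusterLearner_le c D goodᶜ (fun X K => err X K +
        empQuantError (centers X) (tests X) / (c - 4 * δ)) (fun X K => add_nonneg (herr0 X K)
          (div_nonneg (empQuantError_nonneg _ _) hc0.le)) fun X K hout => ?_).trans ?_
      · by_contra! hlt
        have h1 := div_nonneg (empQuantError_nonneg (centers X) (tests X)) hc0.le
        have h2 := herr0 X K
        have herrlt : err X K < 1 := by linarith
        have hX := clusterOutput_ne_none (c := c) (herr1 X K herrlt).1
          ((div_lt_one hc0).1 (by linarith : empQuantError (centers X) (tests X) / _ < 1)).le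
        obtain ⟨D', hD'⟩ := Option.ne_none_iff_exists'.1 hX
        exact hout ⟨D', hD', hsound X K D' herrlt hD'⟩
      · rw [← ENNReal.ofReal_one, ← ENNReal.ofReal_ofNat 3,
          ← ENNReal.ofReal_div_of_pos (by norm_num)]
        refine ENNReal.ofReal_le_ofReal ?_
        calc _ = (iidMean (fun u => (D u).toReal) (s + r) fun X =>
                iidMean (fun _ : Fin n => (1 / n : ℝ)) k fun K => err X K) +
              iidMean (fun u => (D u).toReal) s (fun V => quantError D V) / (c - 4 * δ) := by
              simp only [iidMean_add, iidMean_const hunif, iidMean_div_const]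
              rw [iidMean_empQuantError_append]
          _ ≤ 1 / 6 + (3 * (β + δ + δ) + δ) / (c - 4 * δ) := by
              gcongr
              refine (iidMean_quantError_le htr hM).trans ?_
              gcongr
              calc (M.card : ℝ) * (2 / s) ≤ m * (2 / s) := by gcongr
                _ ≤ δ := by
                  rw [div_lt_iff₀ hδ0] at hs
                  rw [← mul_div_assoc, div_le_iff₀ hs0]
                  linarith
          _ = 1 / 3 := by
              have : c - 4 * δ = 6 * (3 * (β + δ + δ) + δ) := by rw [hc]; ring
              rw [this]
              field_simp
              norm_num
    have hone : 1 ≤ prob run good + prob run goodᶜ := by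
      calc (1 : ENNReal) = run.toOuterMeasure Set.univ := by
            rw [(run.toOuterMeasure_apply_eq_one_iff _).2 (Set.subset_univ _)]
        _ ≤ _ := by
            rw [← Set.union_compl_self good]
            exact MeasureTheory.measure_union_le _ _
    have h23 : (2 / 3 : ENNReal) + 1 / 3 = 1 := by
      rw [← ENNReal.add_div]
      norm_num
      exact ENNReal.div_self (by norm_num) (by norm_num)
    refine (ENNReal.add_le_add_iff_right (a := 1 / 3) (by simp)).1 ?_
    rw [h23]
    exact hone.trans (by gcongr)
  · refine (prob_run_clusterLearner_le c D _ err herr0 fun X K hout => ?_).trans ?_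
    · by_contra! hlt
      obtain ⟨D', hD', hfar⟩ := hout
      obtain ⟨σ, hσ⟩ := hsound X K D' hlt hD'
      exact absurd (hfar σ) (not_lt.2 hσ)
    · rw [← ENNReal.ofReal_one, ← ENNReal.ofReal_ofNat 3,
        ← ENNReal.ofReal_div_of_pos (by norm_num)]
      exact ENNReal.ofReal_le_ofReal (hmean.trans (by norm_num))

theorem prob_mono {Ω : Type*} (p : PMF Ω) {E F : Set Ω} (h : E ⊆ F) : prob p E ≤ prob p F :=
  p.toOuterMeasure.mono h

end HugeObject

theorem theorem4p1 (d : ℕ) :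
    ∃ (s q : ℝ → ℝ → ℕ)
      (A : (n : ℕ) → (α β : ℝ) → NonAdaptiveLearner n (s α β) (q α β)),
      ∀ α β : ℝ, 0 < α → α < 1 → 0 < β → β < 1 → β < α → 17 * (3 * α + β / α) < 1 →
        ∀ n : ℕ, 1 ≤ n → ∀ D : PMF (Cube n),
          (IsCloseToVCDim D β d →
            2 / 3 ≤ prob ((A n α β).run D)
              {o | ∃ D', o = some D' ∧
                ∃ σ : Equiv.Perm (Fin n), emd D (permute σ D') ≤ 17 * (3 * α + β / α)}) ∧
          prob ((A n α β).run D)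
              {o | ∃ D', o = some D' ∧
                ∀ σ : Equiv.Perm (Fin n), 17 * (3 * α + β / α) < emd D (permute σ D')} ≤
            1 / 3 := by
  have key : ∀ α β : ℝ, ∃ (s q : ℕ) (A : (n : ℕ) → NonAdaptiveLearner n s q),
      0 < α → α < 1 → 0 < β → β < 1 → β < α → 17 * (3 * α + β / α) < 1 →
        ∀ n : ℕ, 1 ≤ n → ∀ D : PMF (Cube n),
          (IsCloseToVCDim D β d →
            2 / 3 ≤ prob ((A n).run D)
              {o | ∃ D', o = some D' ∧
                ∃ σ : Equiv.Perm (Fin n), emd D (permute σ D') ≤ 17 * (3 * α + β / α)}) ∧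
          prob ((A n).run D)
              {o | ∃ D', o = some D' ∧
                ∀ σ : Equiv.Perm (Fin n), 17 * (3 * α + β / α) < emd D (permute σ D')} ≤
            1 / 3 := by
    intro α β
    by_cases hpar : 0 < α ∧ 0 < β ∧ 17 * (3 * α + β / α) < 1
    · obtain ⟨hα, hβ, hε⟩ := hpar
      have hβα : 0 < β / α := by positivity
      -- `ε < 1` forces `α < 1 / 51`, so that `β / α` dominates a large multiple of `β`
      have hα51 : 51 * α < 1 := by linarith
      have hβle : 51 * β ≤ β / α := by
        rw [le_div_iff₀ hα]
        nlinarith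
      have hbound : 36 * β + 103 * (α / 10) ≤ 17 * (3 * α + β / α) := by linarith
      obtain ⟨s, r, k, _, _, hA⟩ := exists_clusterLearner d hβ (δ := α / 10)
        (by positivity) (by linarith)
      refine ⟨s + r, (s + r) * k, fun n => if hn : n ≠ 0 then
        haveI : NeZero n := ⟨hn⟩
        clusterLearner n s r k (18 * β + 46 * (α / 10)) else failLearner n _ _, ?_⟩
      intro _ _ _ _ _ _ n hn D
      have hn0 : n ≠ 0 := by omega
      have : NeZero n := ⟨hn0⟩
      simp only [dif_pos hn0]
      obtain ⟨h1, h2⟩ := hA n this D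
      refine ⟨fun hD => (h1 hD).trans (prob_mono _ ?_), (prob_mono _ ?_).trans h2⟩
      · rintro o ⟨D', ho, σ, hσ⟩
        exact ⟨D', ho, σ, hσ.trans hbound⟩
      · rintro o ⟨D', ho, hσ⟩
        exact ⟨D', ho, fun σ => hbound.trans_lt (hσ σ)⟩
    · exact ⟨0, 0, fun n => failLearner n 0 0, fun h1 _ h2 _ _ h3 => absurd ⟨h1, h2, h3⟩ hpar⟩
  choose s q A hA using key
  exact ⟨s, q, fun n α β => A α β n, fun α β => hA α β⟩
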